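/- Let $q$ be a natural number, let $A=(a_1,\ldots,a_q)$, $B=(b_1,\ldots,b_q)$ be vectors of complex numbers such that no $b_j$ belongs to $\{0,-1,-2,\ldots\}$, let $\sigma\in\mathbb{C}$, and put $\psi=\sum_{k=1}^{q}(b_k-a_k)$. Let ${}_{q+1}F_q(\sigma,A;B;\cdot)$ denote the analytic continuation to $\mathbb{C}\setminus[1,\infty)$ of the sum of the series $$\sum_{n=0}^{\infty}\frac{(\sigma)_n(a_1)_n\cdots(a_q)_n}{(b_1)_n\cdots(b_q)_n\,n!}\,z^n\quad(|z|<1),\qquad (x)_n=x(x+1)\cdots(x+n-1).$$ We say that a function $\rho:[0,1]\to\mathbb{C}$ represents ${}_{q+1}F_q$ if $\rho$ is (Lebesgue) summable on $[0,1]$ and $${}_{q+1}F_q(\sigma,A;B;-z)=\int_0^1\frac{\rho(s)\,ds}{(1+sz)^{\sigma}}\qquad\text{for all } z\in\mathbb{C}\setminus(-\infty,-1],\ \text{i.e. } |\arg(1+z)|<\pi,$$ with the principal branch of the power. 1. (Criterion.) Assume that $\sigma\notin\{0,-1,-2,\ldots\}$ and that no $a_i$ with $\Re a_i\le 0$ is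 of the form $b_j+l$ with $1\le j\le q$ and $l\in\{0,1,2,\ldots\}$. Then a representing function $\rho$ exists if and only if $\Re a_i>0$ for $i=1,\ldots,q$ and $\Re\psi>0$. 2. (Necessity in the presence of coinciding parameters.) Assume only that $\sigma\notin\{0,-1,-2,\ldots\}$. If a representing function exists, then $\Re\psi>0$, and $\Re a_i>0$ for every $i$ such that $a_i-b_j\notin\{0,1,2,\ldots\}$ for all $j$. 3. (Formula for $\rho$.) Assume that $\Re a_i>0$ for $i=1,\ldots,q$ and $\Re\psi>0$; here $\sigma\in\mathbb{C}$ is arbitrary. Let $c>-\min_i\Re a_i$. Then for every $s\in(0,1)$ the limit $$G^{q,0}_{q,q}\!\left(s\left|\begin{array}{l}B\\A\end{array}\right.\right)=\lim_{R\to\infty}\frac{1}{2\pi i}\int_{c-iR}^{c+iR}\frac{\Gamma(a_1+t)\cdots\Gamma(a_q+t)}{\Gamma(b_1+t)\cdots\Gamma(b_q+t)}\,s^{-t}\,dt$$ exists, and the function $$\rho(s)=\left(\prod_{i=1}^{q}\frac{\Gamma(b_i)}{\Gamma(a_i)}\right)\frac1s\,G^{q,0}_{q,q}\!\left(s\left|\begin{array}{l}B\\A\end{array}\right.\right)$$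 represents ${}_{q+1}F_q$. If $\sigma\notin\{0,-1,-2,\ldots\}$, every representing function is equal to this $\rho$ almost everywhere on $[0,1]$. -/

import Mathlib

open Filter Topology MeasureTheory

noncomputable section

/-- The rising factorial `(x)_n = x (x + 1) ⋯ (x + n - 1)`. -/
def risingFactorial (x : ℂ) (n : ℕ) : ℂ := ∏ k ∈ Finset.range n, (x + k)

/-- The sum of the power series
`∑ (σ)_n (a_1)_n ⋯ (a_q)_n / ((b_1)_n ⋯ (b_q)_n n!) z ^ n`. -/
def hypSeries {q : ℕ} (σ : ℂ) (a b : Fin q → ℂ) (z : ℂ) : ℂ :=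
  ∑' n : ℕ, risingFactorial σ n * (∏ i, risingFactorial (a i) n) /
    ((∏ j, risingFactorial (b j) n) * (n.factorial : ℂ)) * z ^ n

/-- The plane cut along `[1, ∞)`: all `z` with `1 - z ≠ 0` and `|arg (1 - z)| < π`. -/
def cutPlane : Set ℂ := {z | 1 - z ∈ Complex.slitPlane}

/-- `f` is holomorphic in the plane cut along `[1, ∞)` and is equal to the sum of the
hypergeometric series in the unit disk. -/
def IsHypContinuation {q : ℕ} (σ : ℂ) (a b : Fin q → ℂ) (f : ℂ → ℂ) : Prop :=
  DifferentiableOn ℂ f cutPlane ∧ ∀ z : ℂ, ‖z‖ < 1 → f z = hypSeries σ a b z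

open Classical in
/-- The generalized hypergeometric function `_{q+1}F_q(σ, A; B; z)`: the analytic continuation of
the hypergeometric series to the plane cut along `[1, ∞)`. Values on the cut carry no meaning. -/
def hypF {q : ℕ} (σ : ℂ) (a b : Fin q → ℂ) (z : ℂ) : ℂ :=
  if h : ∃ f : ℂ → ℂ, IsHypContinuation σ a b f then h.choose z else hypSeries σ a b z

/-- `(2 π i)⁻¹ ∫ ∏ Γ(lo_j + s) / ∏ Γ(up_i + s) x ^ (-s) ds` over the segment from `c - i R` to
`c + i R`, parametrized by `s = c + i t`. -/
def meijerGTrunc {p q : ℕ} (c : ℝ) (up : Fin p → ℂ) (lo : Fin q → ℂ) (x : ℂ) (R : ℝ) : ℂ :=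
  (1 / (2 * (Real.pi : ℂ) * Complex.I)) *
    ∫ t in (-R)..R,
      (∏ j, Complex.Gamma (lo j + ((c : ℂ) + t * Complex.I))) /
        (∏ i, Complex.Gamma (up i + ((c : ℂ) + t * Complex.I))) *
        x ^ (-((c : ℂ) + t * Complex.I)) * Complex.I

/-- Meijer's function `G^{q,0}_{p,q}(x | up; lo)`, as the (improper) integral over the vertical
line `Re s = c`, to be used for `c > - min_j Re lo_j`. -/
def meijerG {p q : ℕ} (c : ℝ) (up : Fin p → ℂ) (lo : Fin q → ℂ) (x : ℂ) : ℂ :=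
  limUnder atTop (meijerGTrunc c up lo x)

/-- `ρ(s) = ∏ (Γ(b_i) / Γ(a_i)) s⁻¹ G^{q,0}_{q,q}(s | B; A)`. -/
def hypDensity {q : ℕ} (c : ℝ) (a b : Fin q → ℂ) (s : ℝ) : ℂ :=
  (∏ i, Complex.Gamma (b i) / Complex.Gamma (a i)) * (1 / (s : ℂ)) * meijerG c b a (s : ℂ)

/-- `ρ` is summable on `[0, 1]` and `_{q+1}F_q(σ, A; B; -z) = ∫₀¹ ρ(s) (1 + s z) ^ (-σ) ds` for
all `z` with `|arg (1 + z)| < π` (and `1 + z ≠ 0`). -/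
def IsRepresentedBy {q : ℕ} (σ : ℂ) (a b : Fin q → ℂ) (ρ : ℝ → ℂ) : Prop :=
  IntegrableOn ρ (Set.Icc 0 1) volume ∧
    ∀ z : ℂ, 1 + z ∈ Complex.slitPlane →
      hypF σ a b (-z) = ∫ s in (0 : ℝ)..1, ρ s / (1 + (s : ℂ) * z) ^ σ

/-- `ψ = ∑ (b_k - a_k)`. -/
def hypPsi {q : ℕ} (a b : Fin q → ℂ) : ℂ := ∑ k, (b k - a k)

end

/-!
Expanding `(1 + s z) ^ (-σ)` at `z = 0` shows that, for `σ ∉ {0, -1, -2, …}`, a summable `ρ`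
represents the hypergeometric function if and only if its `n`-th moment is
`∏ (a_i)_n / (b_i)_n = f(n) / f(0)` for all `n`, where `f(w) = ∏ Γ(a_i + w) / Γ(b_i + w)`.

*Existence.* In a right half-plane `f(w)` is of size `|w| ^ (-Re ψ)`, so its inverse Mellin integral
need not converge absolutely. The difference `f(w + 1) - f(w)` gains a factor `1 / |w|`, and its
inverse Mellin integral does. Since multiplication by `s` shifts the Mellin transform by one,
dividing that integral by `s - 1` gives a function with Mellin transform `f`; it vanishes for
`s ≥ 1`, because the line of integration may be moved to `+∞`.

*Necessity.* The moments of a summable `ρ` tend to `0`, while `f(n)` is comparable to `n ^ (-ψ)`;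
hence `Re ψ > 0`. The moments from some index on already determine `ρ`, which therefore has Mellin
transform `f / f(0)` far to the right, and by the identity theorem
`∫₀¹ s ^ w ρ(s) ds · ∏ 1 / Γ(a_i + w) = f(0)⁻¹ ∏ 1 / Γ(b_i + w)` for `Re w ≥ 0`. If `Re a_i ≤ 0`,
the left-hand side vanishes at `w = -a_i`, but the right-hand side does so only if `a_i - b_j ∈ ℕ`
for some `j`.
-/

/-! ### Quotients of gamma functions -/

section GammaQuotient

open Complex Asymptotics Bornology

theorem norm_le_norm_add_ofReal {w : ℂ} {x : ℝ} (hw : 0 ≤ w.re) (hx : 0 ≤ x) :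
    ‖w‖ ≤ ‖w + x‖ := by
  rw [← sq_le_sq₀ (norm_nonneg _) (norm_nonneg _), ← normSq_eq_norm_sq, ← normSq_eq_norm_sq,
    normSq_apply, normSq_apply, add_re, add_im, ofReal_re, ofReal_im]
  nlinarith [mul_nonneg hw hx]

theorem le_norm_add_ofReal {w : ℂ} (hw : 0 ≤ w.re) (x : ℝ) : x ≤ ‖w + x‖ :=
  calc x ≤ (w + x).re := by simpa using hw
    _ ≤ ‖w + x‖ := re_le_norm _

theorem mul_cpow_of_re_nonneg {u v : ℂ} (hu : 0 ≤ u.re) (hu₀ : u ≠ 0) (hv : 0 < v.re) (c : ℂ) :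
    (u * v) ^ c = u ^ c * v ^ c := by
  have hv₀ : v ≠ 0 := by rintro rfl; simp at hv
  have hargu := abs_le.1 (abs_arg_le_pi_div_two_iff.2 hu)
  have hargv := abs_lt.1 (abs_arg_lt_pi_div_two_iff.2 (Or.inl hv))
  rw [cpow_def_of_ne_zero (mul_ne_zero hu₀ hv₀), cpow_def_of_ne_zero hu₀,
    cpow_def_of_ne_zero hv₀, log_mul hu₀ hv₀ ⟨by linarith, by linarith⟩, add_mul, exp_add]

theorem tendsto_natCast_add_cpow_div (x c : ℂ) :
    Tendsto (fun n : ℕ => ((n : ℂ) + x) ^ c / (n : ℂ) ^ c) atTop (𝓝 1) := by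
  have hbase : Tendsto (fun n : ℕ => 1 + x / (n : ℂ)) atTop (𝓝 1) := by
    simpa [div_eq_mul_inv] using (((tendsto_inv₀_cobounded (α := ℂ)).comp
      tendsto_natCast_atTop_cobounded).const_mul x).const_add 1
  have hpow : Tendsto (fun n : ℕ => (1 + x / (n : ℂ)) ^ c) atTop (𝓝 1) := by
    simpa using hbase.cpow (tendsto_const_nhds (x := c)) (by simp)
  have hre : ∀ᶠ n : ℕ in atTop, 0 < (1 + x / (n : ℂ)).re :=
    (continuous_re.tendsto 1 |>.comp hbase).eventually (lt_mem_nhds (by simp))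
  refine hpow.congr' ?_
  filter_upwards [eventually_ne_atTop 0, hre] with n hn hre
  have hn : (n : ℂ) ≠ 0 := Nat.cast_ne_zero.2 hn
  rw [← mul_div_cancel_left₀ ((1 + x / n) ^ c) (show (n : ℂ) ^ c ≠ 0 by simp [hn]),
    ← mul_cpow_of_re_nonneg (by simp) hn hre, mul_add, mul_one, mul_div_cancel₀ _ hn]

theorem Gamma_add_natCast {s : ℂ} (hs : ∀ m : ℕ, s ≠ -m) (n : ℕ) :
    Gamma (s + n) = risingFactorial s n * Gamma s := by
  induction n with
  | zero => simp [risingFactorial]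
  | succ n ih =>
    have hsn : s + n ≠ 0 := fun h => hs n (eq_neg_of_add_eq_zero_left h)
    rw [risingFactorial, Finset.prod_range_succ, ← risingFactorial, Nat.cast_succ, ← add_assoc,
      Gamma_add_one _ hsn, ih]
    ring

theorem tendsto_risingFactorial_div {a : ℂ} (ha : ∀ m : ℕ, a ≠ -m) (b : ℂ) :
    Tendsto (fun n : ℕ => risingFactorial a n / risingFactorial b n * (n : ℂ) ^ (b - a)) atTop
      (𝓝 (Gamma b / Gamma a)) := by
  have hseq : Tendsto (fun n : ℕ => GammaSeq b n / GammaSeq a n * ((b + n) / (a + n))) atTop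
      (𝓝 (Gamma b / Gamma a)) := by
    simpa using ((GammaSeq_tendsto_Gamma b).div (GammaSeq_tendsto_Gamma a) (Gamma_ne_zero ha)).mul
      (tendsto_add_mul_div_add_mul_atTop_nhds b a 1 one_ne_zero)
  refine hseq.congr' ?_
  filter_upwards [eventually_ne_atTop 0, tendsto_natCast_atTop_cobounded.eventually
    (eventually_ne_cobounded (-b))] with n hn hbn
  have hn : (n : ℂ) ≠ 0 := Nat.cast_ne_zero.2 hn
  have han : a + n ≠ 0 := fun h => ha n (eq_neg_of_add_eq_zero_left h)
  have hbn : b + n ≠ 0 := fun h => hbn (eq_neg_of_add_eq_zero_right h)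
  have hfac : (n.factorial : ℂ) ≠ 0 := Nat.cast_ne_zero.2 n.factorial_ne_zero
  have hpow : (n : ℂ) ^ a ≠ 0 := by simp [hn]
  rw [GammaSeq, GammaSeq, Finset.prod_range_succ, Finset.prod_range_succ, cpow_sub _ _ hn,
    risingFactorial, risingFactorial]
  field_simp

theorem tendsto_Gamma_add_natCast_div {a b : ℂ} (ha : ∀ m : ℕ, a ≠ -m) (hb : ∀ m : ℕ, b ≠ -m) :
    Tendsto (fun n : ℕ => Gamma (a + n) / Gamma (b + n) * (n : ℂ) ^ (b - a)) atTop (𝓝 1) := by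
  have hΓa := Gamma_ne_zero ha
  have hΓb := Gamma_ne_zero hb
  have hlim := (tendsto_risingFactorial_div ha b).const_mul (Gamma a / Gamma b)
  rw [show Gamma a / Gamma b * (Gamma b / Gamma a) = 1 by field_simp] at hlim
  refine hlim.congr fun n => ?_
  rw [Gamma_add_natCast ha, Gamma_add_natCast hb]
  ring

theorem norm_le_mul_exp_of_eq_mul_one_add {R : Type*} [NormedCommRing R] [NormOneClass R]
    {φ ε : ℕ → R} {L : R} {g : ℕ → ℝ} (hφ : ∀ n, φ n = φ (n + 1) * (1 + ε n))
    (hlim : Tendsto φ atTop (𝓝 L)) (hε : ∀ n, ‖ε n‖ ≤ g n) (hg : Summable g) :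
    ‖φ 0‖ ≤ ‖L‖ * Real.exp (∑' n, g n) := by
  have htel (n : ℕ) : φ 0 = φ n * ∏ k ∈ Finset.range n, (1 + ε k) := by
    induction n with
    | zero => simp
    | succ n ih => rw [ih, hφ n, Finset.prod_range_succ]; ring
  have hprod (n : ℕ) : ‖∏ k ∈ Finset.range n, (1 + ε k)‖ ≤ Real.exp (∑' k, g k) :=
    calc ‖∏ k ∈ Finset.range n, (1 + ε k)‖
        = ‖(∏ k ∈ Finset.range n, (1 + ε k) - 1) + 1‖ := by rw [sub_add_cancel]
      _ ≤ ‖∏ k ∈ Finset.range n, (1 + ε k) - 1‖ + 1 := by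
        simpa using norm_add_le (∏ k ∈ Finset.range n, (1 + ε k) - 1) 1
      _ ≤ Real.exp (∑ k ∈ Finset.range n, ‖ε k‖) := by
        linarith [Finset.norm_prod_one_add_sub_one_le (Finset.range n) ε]
      _ ≤ Real.exp (∑' k, g k) := Real.exp_le_exp.2 <|
        (Finset.sum_le_sum fun k _ => hε k).trans <|
          hg.sum_le_tsum _ fun k _ => (norm_nonneg _).trans (hε k)
  refine ge_of_tendsto (hlim.norm.mul_const _) (Eventually.of_forall fun n => ?_)
  rw [htel n]
  exact (norm_mul_le _ _).trans (mul_le_mul_of_nonneg_left (hprod n) (norm_nonneg _))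

/-- The function `h` for which `φ(u) = Γ(u + a) / Γ(u + b) · u ^ (b - a)` satisfies
`φ(u) = φ(u + 1) · h(1 / u)`. -/
noncomputable def gammaStep (a b z : ℂ) : ℂ := (1 + b * z) / (1 + a * z) * (1 + z) ^ (a - b)

theorem isBigO_gammaStep_sub_one (a b : ℂ) :
    (fun z => gammaStep a b z - 1) =O[𝓝 0] fun z => z ^ 2 := by
  have han : AnalyticAt ℂ (gammaStep a b) 0 := by
    unfold gammaStep
    exact (((analyticAt_const.add (analyticAt_const.mul analyticAt_id)).div
      (analyticAt_const.add (analyticAt_const.mul analyticAt_id)) (by simp))).mul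
        ((analyticAt_const.add analyticAt_id).cpow analyticAt_const (by simp))
  have hlin (c : ℂ) : HasDerivAt (fun z : ℂ => 1 + c * z) c 0 := by
    simpa using ((hasDerivAt_id (0 : ℂ)).const_mul c).const_add 1
  have hderiv : HasDerivAt (gammaStep a b) 0 0 := by
    have hpow : HasDerivAt (fun z : ℂ => (1 + z) ^ (a - b)) (a - b) 0 := by
      simpa using ((hasDerivAt_id (0 : ℂ)).const_add 1).cpow_const (c := a - b) (by simp)
    have h := ((hlin b).div (hlin a) (by simp)).mul hpow
    simp only [mul_zero, add_zero, mul_one, one_mul, one_pow, div_one, one_cpow] at h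
    exact h.congr_deriv (by simp)
  have hzero : gammaStep a b 0 = 1 := by simp [gammaStep]
  have horder : (2 : ℕ) ≤ analyticOrderAt (fun z => gammaStep a b z - 1) 0 := by
    have h := han.analyticOrderAt_deriv_add_one
    rw [hzero] at h
    rw [← h, Nat.cast_ofNat, ← one_add_one_eq_two]
    gcongr
    rw [Order.one_le_iff_ne_zero, han.deriv.analyticOrderAt_ne_zero, hderiv.deriv]
  obtain ⟨g, hg, hgeq⟩ := (natCast_le_analyticOrderAt (han.sub analyticAt_const)).1 horder
  refine ((isBigO_refl (fun z : ℂ => z ^ 2) (𝓝 0)).mul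
    (hg.continuousAt.isBigO_one ℂ)).congr' ?_ (by simp)
  filter_upwards [hgeq] with z hz
  simpa using hz.symm

theorem gammaStep_inv {a b u : ℂ} (hu : 0 ≤ u.re) (hu₀ : u ≠ 0) (hua : u + a ≠ 0) :
    Gamma (u + a) / Gamma (u + b) * u ^ (b - a) =
      Gamma (u + 1 + a) / Gamma (u + 1 + b) * (u + 1) ^ (b - a) * gammaStep a b u⁻¹ := by
  have hre : 0 < (1 + u⁻¹).re := by
    rw [add_re, one_re, inv_re]
    have := div_nonneg hu (normSq_nonneg u)
    linarith
  have hne : 1 + u⁻¹ ≠ 0 := fun h => by simp [h] at hre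
  have hpow : (u + 1) ^ (b - a) = u ^ (b - a) * (1 + u⁻¹) ^ (b - a) := by
    rw [← mul_cpow_of_re_nonneg hu hu₀ hre, mul_add, mul_one, mul_inv_cancel₀ hu₀]
  have hcancel : (1 + u⁻¹) ^ (b - a) * (1 + u⁻¹) ^ (a - b) = 1 := by
    rw [← cpow_add _ _ hne, sub_add_sub_cancel, sub_self, cpow_zero]
  have hfrac : (1 + b * u⁻¹) / (1 + a * u⁻¹) = (u + b) / (u + a) := by
    have : 1 + a * u⁻¹ ≠ 0 := by
      intro h; apply hua; field_simp at h; simpa using h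
    field_simp
  have hΓb : (Gamma (u + b))⁻¹ = (u + b) * (Gamma (u + 1 + b))⁻¹ := by
    rw [add_right_comm, one_div_Gamma_eq_self_mul_one_div_Gamma_add_one]
  calc Gamma (u + a) / Gamma (u + b) * u ^ (b - a)
      = (u + a) * Gamma (u + a) * (Gamma (u + 1 + b))⁻¹ * u ^ (b - a) *
          ((u + b) / (u + a)) := by rw [div_eq_mul_inv, hΓb]; field_simp
    _ = Gamma (u + 1 + a) / Gamma (u + 1 + b) * u ^ (b - a) * ((u + b) / (u + a)) *
          ((1 + u⁻¹) ^ (b - a) * (1 + u⁻¹) ^ (a - b)) := by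
        rw [hcancel, add_right_comm u 1 a, Gamma_add_one _ hua]; ring
    _ = _ := by rw [hpow, gammaStep, hfrac]; ring

theorem tendsto_Gamma_div_Gamma_mul_cpow {a b u : ℂ} (ha : ∀ m : ℕ, u + a ≠ -m)
    (hb : ∀ m : ℕ, u + b ≠ -m) :
    Tendsto (fun n : ℕ => Gamma (u + n + a) / Gamma (u + n + b) * (u + n) ^ (b - a)) atTop
      (𝓝 1) := by
  have hlim := (tendsto_Gamma_add_natCast_div ha hb).mul
    (tendsto_natCast_add_cpow_div u (b - a))
  rw [mul_one] at hlim
  refine hlim.congr' ?_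
  filter_upwards [eventually_ne_atTop 0] with n hn
  have hpow : (n : ℂ) ^ (b - a) ≠ 0 := by simp [hn]
  rw [add_sub_add_left_eq_sub, add_comm (n : ℂ) u, mul_assoc, mul_div_cancel₀ _ hpow,
    add_right_comm u a, add_right_comm u b]

theorem add_ne_neg_natCast {a u : ℂ} (hu : 0 ≤ u.re) (ha : ‖a‖ < ‖u‖) (m : ℕ) : u + a ≠ -m := by
  intro h
  have hnorm : ‖u + (m : ℝ)‖ = ‖a‖ := by
    rw [← norm_neg a, ofReal_natCast, eq_sub_of_add_eq h]
    ring_nf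
  exact (norm_le_norm_add_ofReal hu m.cast_nonneg).not_gt (hnorm ▸ ha)

theorem ne_neg_natCast_of_re_pos {s : ℂ} (hs : 0 < s.re) (m : ℕ) : s ≠ -m := by
  rintro rfl
  rw [neg_re, natCast_re] at hs
  linarith [m.cast_nonneg (α := ℝ)]

theorem norm_pow_inv_add_natCast_le {u : ℂ} (hu : 0 ≤ u.re) (hu₁ : 1 ≤ ‖u‖) (n k : ℕ) :
    ‖(u + n)⁻¹ ^ k‖ ≤ 2 ^ k * (1 / ((n + 1 : ℕ) : ℝ) ^ k) := by
  have hhalf : ((n : ℝ) + 1) / 2 ≤ ‖u + n‖ := by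
    have h₁ : ‖u‖ ≤ ‖u + n‖ := norm_le_norm_add_ofReal hu n.cast_nonneg
    have h₂ : (n : ℝ) ≤ ‖u + n‖ := le_norm_add_ofReal hu n
    linarith
  rw [norm_pow, norm_inv, mul_one_div, ← div_pow, Nat.cast_succ, ← inv_div]
  gcongr

theorem isBigO_one_Gamma_div_Gamma_mul_cpow (a b : ℂ) :
    (fun u => Gamma (u + a) / Gamma (u + b) * u ^ (b - a))
      =O[cobounded ℂ ⊓ 𝓟 {u | 0 ≤ u.re}] fun _ => (1 : ℝ) := by
  obtain ⟨K, hK, hstep⟩ := (isBigO_gammaStep_sub_one a b).exists_pos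
  obtain ⟨δ, hδ, hball⟩ := Metric.eventually_nhds_iff_ball.1 hstep.bound
  have hlarge (r : ℝ) : ∀ᶠ u in cobounded ℂ ⊓ 𝓟 {u : ℂ | 0 ≤ u.re}, r < ‖u‖ :=
    (tendsto_norm_cobounded_atTop.eventually_gt_atTop r).filter_mono inf_le_left
  have hsum : Summable fun n : ℕ => K * (2 ^ 2 * (1 / ((n + 1 : ℕ) : ℝ) ^ 2)) :=
    .mul_left _ (.mul_left _
      ((summable_nat_add_iff 1).2 (Real.summable_one_div_nat_pow.2 one_lt_two)))
  refine IsBigO.of_bound (Real.exp (∑' n : ℕ, K * (2 ^ 2 * (1 / ((n + 1 : ℕ) : ℝ) ^ 2)))) ?_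
  filter_upwards [hlarge 1, hlarge δ⁻¹, hlarge ‖a‖, hlarge ‖b‖,
    mem_inf_of_right (mem_principal_self _)] with u h₁ hδu hau hbu hu
  have hre (n : ℕ) : 0 ≤ (u + n).re := by
    rw [add_re, natCast_re]; exact add_nonneg hu n.cast_nonneg
  have hle (n : ℕ) : ‖u‖ ≤ ‖u + n‖ := norm_le_norm_add_ofReal hu n.cast_nonneg
  have hne (n : ℕ) : u + n ≠ 0 := norm_pos_iff.1 (by linarith [hle n])
  have hmem (n : ℕ) : (u + n)⁻¹ ∈ Metric.ball 0 δ := by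
    rw [mem_ball_zero_iff, norm_inv, inv_lt_comm₀ (norm_pos_iff.2 (hne n)) hδ]
    exact hδu.trans_le (hle n)
  have hrec (n : ℕ) := gammaStep_inv (b := b) (hre n) (hne n)
    (by simpa using add_ne_neg_natCast (hre n) (hau.trans_le (hle n)) 0)
  simpa using norm_le_mul_exp_of_eq_mul_one_add
    (φ := fun n => Gamma (u + n + a) / Gamma (u + n + b) * (u + n) ^ (b - a))
    (ε := fun n => gammaStep a b (u + n)⁻¹ - 1)
    (fun n => by rw [add_sub_cancel, hrec n, Nat.cast_succ, ← add_assoc])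
    (tendsto_Gamma_div_Gamma_mul_cpow (add_ne_neg_natCast hu hau) (add_ne_neg_natCast hu hbu))
    (fun n => (hball _ (hmem n)).trans
      (mul_le_mul_of_nonneg_left (norm_pow_inv_add_natCast_le hu h₁.le n 2) hK.le)) hsum

theorem isBigO_Gamma_div_Gamma_cobounded (a b : ℂ) :
    (fun u => Gamma (u + a) / Gamma (u + b)) =O[cobounded ℂ ⊓ 𝓟 {u | 0 ≤ u.re}]
      fun u => ‖u‖ ^ (a - b).re := by
  have hne : ∀ᶠ u in cobounded ℂ ⊓ 𝓟 {u : ℂ | 0 ≤ u.re}, u ≠ 0 :=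
    (eventually_ne_cobounded 0).filter_mono inf_le_left
  have hcpow := isTheta_cpow_const_rpow (b := a - b) fun _ _ => hne
  refine ((isBigO_one_Gamma_div_Gamma_mul_cpow a b).mul hcpow.isBigO).congr' ?_ (by simp)
  filter_upwards [hne] with u hu
  rw [mul_assoc, ← cpow_add _ _ hu, sub_add_sub_cancel, sub_self, cpow_zero, mul_one]

theorem isBigO_principal_of_cobounded {E F G : Type*} [PseudoMetricSpace E] [ProperSpace E]
    [SeminormedAddCommGroup F] [NormedAddCommGroup G] {s : Set E} {f : E → F} {g : E → G}
    (hs : IsClosed s) (hf : ContinuousOn f s) (hg : ContinuousOn g s) (hg₀ : ∀ x ∈ s, g x ≠ 0)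
    (h : f =O[cobounded E ⊓ 𝓟 s] g) : f =O[𝓟 s] g := by
  obtain ⟨C, hC⟩ := h.bound
  obtain ⟨t, ht, hts⟩ := eventually_inf_principal.1 hC |>.exists_mem
  set k := s ∩ closure tᶜ
  have hk : IsCompact k := (isBounded_def.2 (by rwa [compl_compl])).isCompact_closure.inter_left hs
  have hfar : f =O[𝓟 (s ∩ t)] g :=
    isBigO_principal.2 ⟨C, fun x hx => hts x hx.2 hx.1⟩
  have hnear : f =O[𝓟 k] g :=
    ((hf.mono Set.inter_subset_left).isBigO_principal hk (c := (1 : ℝ)) (by simp)).trans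
      ((hg.mono Set.inter_subset_left).isBigO_rev_principal hk (fun x hx => hg₀ x hx.1) 1)
  refine (hfar.sup hnear).mono ?_
  rw [sup_principal, le_principal_iff, mem_principal]
  intro x hx
  by_cases hxt : x ∈ t
  · exact Or.inl ⟨hx, hxt⟩
  · exact Or.inr ⟨hx, subset_closure hxt⟩

theorem isTheta_one_add_norm_add_rpow {E : Type*} [SeminormedAddCommGroup E] (d : E) (r : ℝ) :
    (fun w => (1 + ‖w + d‖) ^ r) =Θ[⊤] fun w => (1 + ‖w‖) ^ r := by
  have hle (w d : E) : 1 + ‖w + d‖ ≤ (1 + ‖d‖) * (1 + ‖w‖) := by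
    nlinarith [norm_add_le w d, norm_nonneg w, norm_nonneg d]
  refine IsTheta.rpow (Eventually.of_forall fun w => by positivity)
    (Eventually.of_forall fun w => by positivity) ⟨.of_bound (1 + ‖d‖) ?_, .of_bound (1 + ‖d‖) ?_⟩
  · exact Eventually.of_forall fun w => by simpa [abs_of_nonneg, add_nonneg] using hle w d
  · refine Eventually.of_forall fun w => ?_
    simpa [abs_of_nonneg, add_nonneg] using hle (w + d) (-d)

theorem isTheta_cobounded_norm_rpow {E : Type*} [SeminormedAddCommGroup E] (r : ℝ) :
    (fun w : E => ‖w‖ ^ r) =Θ[cobounded E] fun w => (1 + ‖w‖) ^ r := by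
  refine IsTheta.rpow (Eventually.of_forall norm_nonneg)
    (Eventually.of_forall fun w => by positivity) ⟨.of_bound 1 ?_, .of_bound 2 ?_⟩
  · exact Eventually.of_forall fun w => by
      simp [abs_of_nonneg, add_nonneg]
  · filter_upwards [tendsto_norm_cobounded_atTop.eventually_ge_atTop 1] with w hw
    rw [Real.norm_of_nonneg (by positivity), norm_norm]
    linarith

theorem continuous_one_add_norm_rpow {E : Type*} [SeminormedAddCommGroup E] (r : ℝ) :
    Continuous fun w : E => (1 + ‖w‖) ^ r :=
  (continuous_const.add continuous_norm).rpow_const fun w => Or.inl (show 1 + ‖w‖ ≠ 0 by positivity)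

theorem differentiableAt_Gamma_div_Gamma {a w : ℂ} (ha : 0 < (a + w).re) (b : ℂ) :
    DifferentiableAt ℂ (fun w => Gamma (a + w) / Gamma (b + w)) w := by
  simp_rw [div_eq_mul_inv]
  exact ((differentiableAt_Gamma _ (ne_neg_natCast_of_re_pos ha)).comp w
    (differentiableAt_id.const_add a)).mul
    ((differentiable_one_div_Gamma _).comp w (differentiableAt_id.const_add b))

theorem isBigO_Gamma_div_Gamma {a : ℂ} {c : ℝ} (ha : 0 < a.re + c) (b : ℂ) :
    (fun w => Gamma (a + w) / Gamma (b + w)) =O[𝓟 {w | c ≤ w.re}]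
      fun w => (1 + ‖w‖) ^ (a - b).re := by
  have hcont : ContinuousOn (fun u => Gamma ((a + c) + u) / Gamma ((b + c) + u))
      {u | 0 ≤ u.re} := fun u (hu : 0 ≤ u.re) =>
    have hre : 0 < (a + c + u).re := by simpa using by linarith
    (differentiableAt_Gamma_div_Gamma hre _).continuousAt.continuousWithinAt
  have hinfty : (fun u => Gamma ((a + c) + u) / Gamma ((b + c) + u))
      =O[cobounded ℂ ⊓ 𝓟 {u | 0 ≤ u.re}] fun u => (1 + ‖u‖) ^ (a - b).re := by
    have h := isBigO_Gamma_div_Gamma_cobounded (a + c) (b + c)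
    simp only [add_sub_add_right_eq_sub, add_comm _ (_ + _)] at h
    exact h.trans ((isTheta_cobounded_norm_rpow _).isBigO.mono inf_le_left)
  have hhalf : (fun u => Gamma ((a + c) + u) / Gamma ((b + c) + u)) =O[𝓟 {u | 0 ≤ u.re}]
      fun u => (1 + ‖u‖) ^ (a - b).re :=
    isBigO_principal_of_cobounded (isClosed_le continuous_const continuous_re) hcont
      (continuous_one_add_norm_rpow _).continuousOn (fun u _ => by positivity) hinfty
  have hshift : Tendsto (fun w : ℂ => w + -c) (𝓟 {w | c ≤ w.re}) (𝓟 {u | 0 ≤ u.re}) :=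
    tendsto_principal_principal.2 fun w hw => by simpa using hw
  refine ((hhalf.comp_tendsto hshift).congr_left fun w => ?_).trans
    ((isTheta_one_add_norm_add_rpow (-(c : ℂ)) (a - b).re).isBigO.mono le_top)
  simp only [Function.comp_apply]
  ring_nf

end GammaQuotient

section MellinSymbol

open Complex Asymptotics Bornology
open scoped fwdDiff

/-- The class of functions on the half-plane `c ≤ re w` that are shown to be Mellin transforms of
summable functions on `(0, 1)`: they have order `‖w‖ ^ (-p)` with `p > 0`, and the forward
difference gains one power. The weight `1 + ‖w‖` only avoids the singularity at `w = 0`. -/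
structure IsMellinSymbol (f : ℂ → ℂ) (p c : ℝ) : Prop where
  pos : 0 < p
  differentiableAt : ∀ w : ℂ, c ≤ w.re → DifferentiableAt ℂ f w
  isBigO : f =O[𝓟 {w | c ≤ w.re}] fun w => (1 + ‖w‖) ^ (-p)
  isBigO_fwdDiff : Δ_[1] f =O[𝓟 {w | c ≤ w.re}] fun w => (1 + ‖w‖) ^ (-(p + 1))

/-- The Mellin transform of the Meijer function `G^{q,0}_{q,q}(s | b; a)`. -/
noncomputable def gammaProd {q : ℕ} (a b : Fin q → ℂ) (w : ℂ) : ℂ :=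
  (∏ i, Gamma (a i + w)) / ∏ i, Gamma (b i + w)

theorem isBigO_finsetProd_sub_one {α ι R : Type*} [NormedCommRing R] {l : Filter α}
    {g : α → ℝ} {f : ι → α → R} (s : Finset ι) (hg : g =O[l] fun _ => (1 : ℝ))
    (hf : ∀ i ∈ s, (fun x => f i x - 1) =O[l] g) : (fun x => ∏ i ∈ s, f i x - 1) =O[l] g := by
  classical
  induction s using Finset.induction_on with
  | empty => simpa using isBigO_zero g l
  | insert i s hi ih =>
    have hfi := hf i (Finset.mem_insert_self i s)
    have hprod := ih fun j hj => hf j (Finset.mem_insert_of_mem hj)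
    have hmul : (fun x => (f i x - 1) * (∏ j ∈ s, f j x - 1)) =O[l] g := by
      simpa using (hfi.trans hg).mul hprod
    refine ((hmul.add hfi).add hprod).congr_left fun x => ?_
    rw [Finset.prod_insert hi]
    ring

theorem isBigO_inv_add {a : ℂ} {c : ℝ} (ha : 0 < a.re + c) :
    (fun w : ℂ => (a + w)⁻¹) =O[𝓟 {w | c ≤ w.re}] fun w => (1 + ‖w‖) ^ (-1 : ℝ) := by
  refine IsBigO.trans ?_ ((isTheta_one_add_norm_add_rpow a (-1)).isBigO.mono le_top)
  refine isBigO_principal.2 ⟨1 / (a.re + c) + 1, fun w (hw : c ≤ w.re) => ?_⟩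
  have hre : a.re + c ≤ ‖w + a‖ := (by rw [add_re]; linarith : _ ≤ (w + a).re).trans (re_le_norm _)
  have hpos : 0 < ‖w + a‖ := ha.trans_le hre
  rw [add_comm a, Real.rpow_neg_one, norm_inv, Real.norm_of_nonneg (by positivity),
    ← div_eq_mul_inv, inv_eq_one_div, div_le_div_iff₀ hpos (by positivity), one_mul, add_mul,
    one_mul, div_mul_eq_mul_div, one_mul]
  gcongr
  exact (one_le_div ha).2 hre

theorem isBigO_prod_div_sub_one {q : ℕ} {a : Fin q → ℂ} {c : ℝ} (ha : ∀ i, -(a i).re < c)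
    (b : Fin q → ℂ) :
    (fun w : ℂ => ∏ i, (b i + w) / (a i + w) - 1) =O[𝓟 {w | c ≤ w.re}]
      fun w => (1 + ‖w‖) ^ (-1 : ℝ) := by
  refine isBigO_finsetProd_sub_one _ (.of_bound 1 (Eventually.of_forall fun w => ?_))
    fun i _ => ?_
  · rw [Real.rpow_neg_one, norm_inv, norm_one, mul_one, Real.norm_of_nonneg (by positivity)]
    exact inv_le_one_of_one_le₀ (by linarith [norm_nonneg w])
  · refine ((isBigO_inv_add (a := a i) (by linarith [ha i])).const_mul_left (b i - a i)).congr' ?_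
      EventuallyEq.rfl
    filter_upwards [mem_principal_self _] with w (hw : c ≤ w.re)
    have hne : a i + w ≠ 0 := fun h => by
      have := congrArg re h
      rw [add_re, zero_re] at this
      linarith [ha i]
    field_simp
    ring

section GammaProd

variable {q : ℕ} {a : Fin q → ℂ}

theorem gammaProd_eq_prod_div (a b : Fin q → ℂ) (w : ℂ) :
    gammaProd a b w = ∏ i, Gamma (a i + w) / Gamma (b i + w) :=
  (Finset.prod_div_distrib _ _).symm

theorem gammaProd_eq_gammaProd_add_one_mul (b : Fin q → ℂ) {w : ℂ} (hw : ∀ i, a i + w ≠ 0) :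
    gammaProd a b w = gammaProd a b (w + 1) * ∏ i, (b i + w) / (a i + w) := by
  rw [gammaProd_eq_prod_div, gammaProd_eq_prod_div, ← Finset.prod_mul_distrib]
  refine Finset.prod_congr rfl fun i _ => ?_
  have := hw i
  rw [← add_assoc, ← add_assoc, Gamma_add_one _ this, div_eq_mul_inv (Gamma (a i + w)),
    one_div_Gamma_eq_self_mul_one_div_Gamma_add_one]
  field_simp

theorem differentiableAt_gammaProd (b : Fin q → ℂ) {w : ℂ} (hw : ∀ i, -(a i).re < w.re) :
    DifferentiableAt ℂ (gammaProd a b) w := by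
  rw [funext (gammaProd_eq_prod_div a b)]
  refine DifferentiableAt.fun_finsetProd fun i _ => differentiableAt_Gamma_div_Gamma ?_ _
  rw [add_re]
  linarith [hw i]

variable {c : ℝ}

theorem isBigO_gammaProd (ha : ∀ i, -(a i).re < c) (b : Fin q → ℂ) :
    gammaProd a b =O[𝓟 {w | c ≤ w.re}] fun w => (1 + ‖w‖) ^ (-(hypPsi a b).re) := by
  rw [funext (gammaProd_eq_prod_div a b)]
  have hψ : -(hypPsi a b).re = ∑ i, (a i - b i).re := by simp [hypPsi]
  simp_rw [hψ, Real.rpow_sum_of_pos (show 0 < 1 + ‖(_ : ℂ)‖ by positivity)]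
  exact IsBigO.finsetProd fun i _ => isBigO_Gamma_div_Gamma (by linarith [ha i]) (b i)

theorem isBigO_fwdDiff_gammaProd (ha : ∀ i, -(a i).re < c) (b : Fin q → ℂ) :
    Δ_[1] (gammaProd a b) =O[𝓟 {w | c ≤ w.re}]
      fun w => (1 + ‖w‖) ^ (-((hypPsi a b).re + 1)) := by
  have hshift : Tendsto (fun w : ℂ => w + 1) (𝓟 {w | c ≤ w.re}) (𝓟 {w | c ≤ w.re}) :=
    tendsto_principal_principal.2 fun w (hw : c ≤ w.re) => by
      simpa using hw.trans (by linarith)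
  have hsucc : (fun w => gammaProd a b (w + 1)) =O[𝓟 {w | c ≤ w.re}]
      fun w => (1 + ‖w‖) ^ (-(hypPsi a b).re) :=
    ((isBigO_gammaProd ha b).comp_tendsto hshift).trans
      ((isTheta_one_add_norm_add_rpow (1 : ℂ) _).isBigO.mono le_top)
  refine (hsucc.mul (isBigO_prod_div_sub_one ha b)).neg_left.congr' ?_
    (Eventually.of_forall fun w => ?_)
  · filter_upwards [mem_principal_self _] with w (hw : c ≤ w.re)
    rw [fwdDiff, gammaProd_eq_gammaProd_add_one_mul b (w := w) fun i h => ?_]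
    · ring
    · have := congrArg re h
      rw [add_re, zero_re] at this
      linarith [ha i]
  · simp only [neg_add, Real.rpow_add (show 0 < 1 + ‖w‖ by positivity)]

theorem isMellinSymbol_gammaProd {b : Fin q → ℂ} (ha : ∀ i, -(a i).re < c)
    (hψ : 0 < (hypPsi a b).re) : IsMellinSymbol (gammaProd a b) (hypPsi a b).re c where
  pos := hψ
  differentiableAt _ hw := differentiableAt_gammaProd b fun i => (ha i).trans_le hw
  isBigO := isBigO_gammaProd ha b
  isBigO_fwdDiff := isBigO_fwdDiff_gammaProd ha b

end GammaProd

end MellinSymbol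

/-! ### Mellin inversion -/

section VerticalLines

open Complex Bornology

variable {E : Type*} [NormedAddCommGroup E] [NormedSpace ℂ E] {c c₁ c₂ s : ℝ}

theorem tendsto_integral_horizontal {F : ℂ → E} (hc : c₁ ≤ c₂)
    (hF : Tendsto F (cobounded ℂ ⊓ 𝓟 (re ⁻¹' Set.Icc c₁ c₂)) (𝓝 0)) {l : Filter ℝ}
    (hl : l ≤ cobounded ℝ) :
    Tendsto (fun R : ℝ => ∫ x in c₁..c₂, F (x + R * I)) l (𝓝 0) := by
  rw [NormedAddGroup.tendsto_nhds_zero] at hF ⊢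
  intro ε hε
  have hlen : 0 < c₂ - c₁ + 1 := by linarith
  obtain ⟨T, -, hT⟩ := ((hasBasis_cobounded_norm (E := ℂ)).inf_principal _).eventually_iff.1
    (hF (ε / (c₂ - c₁ + 1)) (div_pos hε hlen))
  filter_upwards [hl (hasBasis_cobounded_norm.mem_of_mem (i := T) trivial)] with R (hR : T ≤ ‖R‖)
  have hle : ∀ x ∈ Set.uIoc c₁ c₂, ‖F (x + R * I)‖ ≤ ε / (c₂ - c₁ + 1) := fun x hx => by
    rw [Set.uIoc_of_le hc] at hx
    refine (hT ⟨hR.trans ?_, ?_⟩).le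
    · simpa using abs_im_le_norm ((x : ℂ) + R * I)
    · simpa using ⟨hx.1.le, hx.2⟩
  refine (intervalIntegral.norm_integral_le_of_norm_le_const hle).trans_lt ?_
  rw [abs_of_nonneg (sub_nonneg.2 hc), div_mul_eq_mul_div, div_lt_iff₀ hlen]
  exact mul_lt_mul_of_pos_left (lt_add_one _) hε

theorem tendsto_integral_vertical_sub {F : ℂ → E} (hc : c₁ ≤ c₂)
    (hd : DifferentiableOn ℂ F (re ⁻¹' Set.Icc c₁ c₂))
    (hF : Tendsto F (cobounded ℂ ⊓ 𝓟 (re ⁻¹' Set.Icc c₁ c₂)) (𝓝 0)) :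
    Tendsto (fun R : ℝ => (∫ y in (-R)..R, F (c₂ + y * I)) - ∫ y in (-R)..R, F (c₁ + y * I))
      atTop (𝓝 0) := by
  have hbottom := tendsto_integral_horizontal hc hF (l := map Neg.neg atTop) (by simp)
  have htop := tendsto_integral_horizontal hc hF (l := atTop) (by simp)
  have h := ((tendsto_map'_iff.1 hbottom).sub htop).const_smul I
  rw [sub_zero, smul_zero] at h
  refine h.congr fun R => ?_
  have := integral_boundary_rect_eq_zero_of_differentiableOn F (c₁ + (-R : ℝ) * I) (c₂ + R * I)
    (hd.mono fun w hw => ?_)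
  · simp only [add_re, mul_re, ofReal_re, ofReal_im, I_re, I_im, mul_zero, add_im, mul_im, mul_one,
      zero_add, add_zero, sub_self] at this
    rw [add_sub_assoc, ← smul_sub] at this
    rw [Function.comp_apply, eq_neg_of_add_eq_zero_left this]
    simp [smul_smul]
  · simpa [Set.uIcc_of_le hc] using hw.1

theorem norm_ofReal_cpow_neg_add_mul_I (hs : 0 < s) (c y : ℝ) :
    ‖(s : ℂ) ^ (-((c : ℂ) + y * I))‖ = s ^ (-c) := by
  simp [norm_cpow_eq_rpow_re_of_pos hs]

theorem continuous_ofReal_cpow_neg_add_mul_I (hs : 0 < s) (c : ℝ) :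
    Continuous fun y : ℝ => (s : ℂ) ^ (-((c : ℂ) + y * I)) :=
  .const_cpow (by fun_prop) (Or.inl (ofReal_ne_zero.2 hs.ne'))

theorem integrable_cpow_neg_smul {f : ℂ → E} (hs : 0 < s) (hf : VerticalIntegrable f c) :
    Integrable fun y : ℝ => (s : ℂ) ^ (-((c : ℂ) + y * I)) • f (c + y * I) :=
  hf.bdd_smul (s ^ (-c)) (continuous_ofReal_cpow_neg_add_mul_I hs c).aestronglyMeasurable
    (Eventually.of_forall fun y => (norm_ofReal_cpow_neg_add_mul_I hs c y).le)

theorem norm_mellinInv_le (hs : 0 < s) (c : ℝ) (f : ℂ → E) :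
    ‖mellinInv c f s‖ ≤ s ^ (-c) * ∫ y : ℝ, ‖f (c + y * I)‖ := by
  have hπ : 1 / (2 * Real.pi) ≤ 1 := by
    rw [div_le_one (by positivity)]
    linarith [Real.pi_gt_three]
  rw [mellinInv, norm_smul, Real.norm_of_nonneg (by positivity), ← integral_const_mul]
  refine (mul_le_of_le_one_left (norm_nonneg _) hπ).trans
    ((norm_integral_le_integral_norm _).trans_eq ?_)
  simp only [norm_smul, norm_ofReal_cpow_neg_add_mul_I hs]

/-- The inverse Mellin transform over the segment from `c - i R` to `c + i R`. -/
noncomputable def mellinInvTrunc (c : ℝ) (f : ℂ → E) (s R : ℝ) : E :=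
  (1 / (2 * Real.pi)) • ∫ y in (-R)..R, (s : ℂ) ^ (-((c : ℂ) + y * I)) • f (c + y * I)

theorem tendsto_mellinInvTrunc {f : ℂ → E} (hs : 0 < s) (hf : VerticalIntegrable f c) :
    Tendsto (mellinInvTrunc c f s) atTop (𝓝 (mellinInv c f s)) :=
  (intervalIntegral_tendsto_integral (integrable_cpow_neg_smul hs hf)
    tendsto_neg_atTop_atBot tendsto_id).const_smul _

theorem tendsto_mellinInvTrunc_sub {f : ℂ → E} (hc : c₁ ≤ c₂) (hs : 0 < s)
    (hd : DifferentiableOn ℂ f (re ⁻¹' Set.Icc c₁ c₂))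
    (hf : Tendsto f (cobounded ℂ ⊓ 𝓟 (re ⁻¹' Set.Icc c₁ c₂)) (𝓝 0)) :
    Tendsto (fun R => mellinInvTrunc c₂ f s R - mellinInvTrunc c₁ f s R) atTop (𝓝 0) := by
  have hs' : (s : ℂ) ≠ 0 := ofReal_ne_zero.2 hs.ne'
  have hcpow : Differentiable ℂ fun w : ℂ => (s : ℂ) ^ (-w) :=
    differentiable_id.neg.const_cpow (Or.inl hs')
  have hbdd : IsBoundedUnder (· ≤ ·) (cobounded ℂ ⊓ 𝓟 (re ⁻¹' Set.Icc c₁ c₂))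
      (norm ∘ fun w : ℂ => (s : ℂ) ^ (-w)) := by
    obtain ⟨B, hB⟩ := isCompact_Icc.exists_bound_of_continuousOn
      (f := fun x : ℝ => s ^ (-x)) (s := Set.Icc c₁ c₂)
      (continuous_const.rpow continuous_neg fun _ => Or.inl hs.ne').continuousOn
    refine ⟨B, eventually_map.2 (eventually_inf_principal.2 (Eventually.of_forall fun w hw => ?_))⟩
    simpa [norm_cpow_eq_rpow_re_of_pos hs] using (le_abs_self _).trans (hB w.re hw)
  have h := tendsto_integral_vertical_sub hc (hcpow.differentiableOn.smul hd)
    (hbdd.smul_tendsto_zero hf)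
  simpa [mellinInvTrunc, smul_sub] using h.const_smul (1 / (2 * Real.pi))

theorem mellinInv_eq_mellinInv_of_le {f : ℂ → E} (hc : c₁ ≤ c₂) (hs : 0 < s)
    (hd : DifferentiableOn ℂ f (re ⁻¹' Set.Icc c₁ c₂))
    (hf : Tendsto f (cobounded ℂ ⊓ 𝓟 (re ⁻¹' Set.Icc c₁ c₂)) (𝓝 0))
    (hf₁ : VerticalIntegrable f c₁) (hf₂ : VerticalIntegrable f c₂) :
    mellinInv c₁ f s = mellinInv c₂ f s :=
  (sub_eq_zero.1 (tendsto_nhds_unique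
    ((tendsto_mellinInvTrunc hs hf₂).sub (tendsto_mellinInvTrunc hs hf₁))
    (tendsto_mellinInvTrunc_sub hc hs hd hf))).symm

end VerticalLines

section MellinDensity

open Complex Asymptotics Bornology
open scoped fwdDiff

theorem one_add_norm_rpow_neg_le {c h y r ε : ℝ} (hh : 0 < h) (hε : 0 ≤ ε) (hεr : ε ≤ r) :
    (1 + ‖((c + h : ℝ) : ℂ) + y * I‖) ^ (-r) ≤
      (1 + ‖y‖) ^ (-(r - ε)) * (h / (1 + |c|)) ^ (-ε) := by
  set w : ℂ := ((c + h : ℝ) : ℂ) + y * I with hw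
  have him : 1 + ‖y‖ ≤ 1 + ‖w‖ := by simpa [hw] using abs_im_le_norm w
  have hre : h / (1 + |c|) ≤ 1 + ‖w‖ := by
    have hle : |c + h| ≤ ‖w‖ := by simpa [hw] using abs_re_le_norm w
    rw [div_le_iff₀ (by positivity)]
    nlinarith [le_abs_self (c + h), neg_abs_le c, abs_nonneg c, norm_nonneg w]
  rw [show -r = -(r - ε) + -ε by ring, Real.rpow_add (by positivity)]
  exact mul_le_mul (Real.rpow_le_rpow_of_nonpos (by positivity) him (by linarith))
    (Real.rpow_le_rpow_of_nonpos (by positivity) hre (by linarith)) (by positivity) (by positivity)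

theorem tendsto_one_add_norm_rpow_neg {E : Type*} [SeminormedAddCommGroup E] {r : ℝ}
    (hr : 0 < r) : Tendsto (fun w : E => (1 + ‖w‖) ^ (-r)) (cobounded E) (𝓝 0) :=
  (tendsto_rpow_neg_atTop hr).comp (tendsto_atTop_add_const_left _ 1 tendsto_norm_cobounded_atTop)

theorem stronglyMeasurable_mellinInv {E : Type*} [NormedAddCommGroup E] [NormedSpace ℂ E]
    {g : ℂ → E} {c : ℝ} (hg : Continuous fun y : ℝ => g (c + y * I)) :
    StronglyMeasurable (mellinInv c g) := by
  have hcpow : Measurable fun x : ℝ × ℝ => (x.1 : ℂ) ^ (-((c : ℂ) + x.2 * I)) :=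
    (by fun_prop : Measurable fun x : ℝ × ℝ => (x.1 : ℂ)).pow (by fun_prop)
  exact ((hcpow.stronglyMeasurable.smul
    (hg.stronglyMeasurable.comp_measurable measurable_snd)).integral_prod_right').const_smul _

/-- The function with Mellin transform `f`: multiplying it by `s - 1` turns its Mellin transform
into `Δ_[1] f`, whose inverse Mellin integral, unlike that of `f`, converges absolutely. -/
noncomputable def mellinDensity (c : ℝ) (f : ℂ → ℂ) (s : ℝ) : ℂ :=
  mellinInv c (Δ_[1] f) s / (s - 1)

namespace IsMellinSymbol

variable {f : ℂ → ℂ} {p c c' ε s : ℝ}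

theorem differentiableAt_fwdDiff (hf : IsMellinSymbol f p c) {w : ℂ} (hw : c ≤ w.re) :
    DifferentiableAt ℂ (Δ_[1] f) w := by
  have hsucc : DifferentiableAt ℂ f (w + 1) :=
    hf.differentiableAt _ (by simpa using hw.trans (by linarith))
  exact (hsucc.comp w (differentiableAt_id.add_const 1)).sub (hf.differentiableAt w hw)

theorem continuous_fwdDiff_vertical (hf : IsMellinSymbol f p c) (hc : c ≤ c') :
    Continuous fun y : ℝ => Δ_[1] f (c' + y * I) :=
  continuous_iff_continuousAt.2 fun y =>
    (hf.differentiableAt_fwdDiff (by simpa using hc)).continuousAt.comp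
      (f := fun y : ℝ => (c' : ℂ) + y * I) (by fun_prop)

theorem continuous_vertical (hf : IsMellinSymbol f p c) (hc : c ≤ c') :
    Continuous fun y : ℝ => f (c' + y * I) :=
  continuous_iff_continuousAt.2 fun y =>
    (hf.differentiableAt _ (by simpa using hc)).continuousAt.comp
      (f := fun y : ℝ => (c' : ℂ) + y * I) (by fun_prop)

theorem tendsto_cobounded (hf : IsMellinSymbol f p c) :
    Tendsto f (cobounded ℂ ⊓ 𝓟 {w | c ≤ w.re}) (𝓝 0) :=
  (hf.isBigO.mono inf_le_right).trans_tendsto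
    ((tendsto_one_add_norm_rpow_neg hf.pos).mono_left inf_le_left)

theorem tendsto_fwdDiff_cobounded (hf : IsMellinSymbol f p c) :
    Tendsto (Δ_[1] f) (cobounded ℂ ⊓ 𝓟 {w | c ≤ w.re}) (𝓝 0) :=
  (hf.isBigO_fwdDiff.mono inf_le_right).trans_tendsto
    ((tendsto_one_add_norm_rpow_neg (by linarith [hf.pos])).mono_left inf_le_left)

theorem verticalIntegrable_fwdDiff (hf : IsMellinSymbol f p c) (hc : c ≤ c') :
    VerticalIntegrable (Δ_[1] f) c' := by
  obtain ⟨C, hC₀, hC⟩ := hf.isBigO_fwdDiff.exists_nonneg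
  refine ((integrable_one_add_norm (E := ℝ) (r := p + 1) (by simpa using hf.pos)).const_mul
    C).mono' (hf.continuous_fwdDiff_vertical hc).aestronglyMeasurable
    (Eventually.of_forall fun y => (isBigOWith_principal.1 hC _ (by simpa using hc)).trans ?_)
  rw [Real.norm_of_nonneg (by positivity)]
  gcongr C * ?_
  refine Real.rpow_le_rpow_of_nonpos (by positivity) ?_ (by linarith [hf.pos])
  simpa using abs_im_le_norm ((c' : ℂ) + y * I)

theorem mellinInv_fwdDiff_eq (hf : IsMellinSymbol f p c) (hc : c ≤ c') (hs : 0 < s) :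
    mellinInv c (Δ_[1] f) s = mellinInv c' (Δ_[1] f) s :=
  mellinInv_eq_mellinInv_of_le hc hs
    (fun _ hw => (hf.differentiableAt_fwdDiff hw.1).differentiableWithinAt)
    (hf.tendsto_fwdDiff_cobounded.mono_left
      (inf_le_inf_left _ (principal_mono.2 fun _ hw => hw.1)))
    (hf.verticalIntegrable_fwdDiff le_rfl) (hf.verticalIntegrable_fwdDiff hc)

theorem exists_integral_norm_fwdDiff_le (hf : IsMellinSymbol f p c) (hε : 0 < ε) (hεp : ε < p) :
    ∃ K : ℝ, ∀ h : ℝ, 0 < h →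
      ∫ y : ℝ, ‖Δ_[1] f ((c + h : ℝ) + y * I)‖ ≤ K * (h / (1 + |c|)) ^ (-ε) := by
  obtain ⟨C, hC₀, hC⟩ := hf.isBigO_fwdDiff.exists_nonneg
  have hint : Integrable fun y : ℝ => (1 + ‖y‖) ^ (-(p + 1 - ε)) :=
    integrable_one_add_norm (by simpa using by linarith)
  refine ⟨C * ∫ y : ℝ, (1 + ‖y‖) ^ (-(p + 1 - ε)), fun h hh => ?_⟩
  rw [mul_assoc, ← integral_mul_const, ← integral_const_mul]
  refine integral_mono (hf.verticalIntegrable_fwdDiff (by linarith)).norm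
    ((hint.mul_const _).const_mul C) fun y =>
    (isBigOWith_principal.1 hC _ (by simpa using hh.le)).trans ?_
  rw [Real.norm_of_nonneg (by positivity)]
  gcongr C * ?_
  exact one_add_norm_rpow_neg_le hh hε.le (by linarith)

theorem exists_norm_mellinInv_fwdDiff_le (hf : IsMellinSymbol f p c) (hε : 0 < ε) (hεp : ε < p) :
    ∃ K : ℝ, ∀ s h : ℝ, 0 < s → 0 < h →
      ‖mellinInv c (Δ_[1] f) s‖ ≤ s ^ (-(c + h)) * (K * (h / (1 + |c|)) ^ (-ε)) := by
  obtain ⟨K, hK⟩ := hf.exists_integral_norm_fwdDiff_le hε hεp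
  refine ⟨K, fun s h hs hh => ?_⟩
  rw [hf.mellinInv_fwdDiff_eq (c' := c + h) (by linarith) hs]
  exact (norm_mellinInv_le hs _ _).trans (by gcongr; exact hK h hh)

theorem mellinInv_fwdDiff_eq_zero (hf : IsMellinSymbol f p c) (hs : 1 ≤ s) :
    mellinInv c (Δ_[1] f) s = 0 := by
  obtain ⟨K, hK⟩ := hf.exists_norm_mellinInv_fwdDiff_le (half_pos hf.pos) (half_lt_self hf.pos)
  have hlim : Tendsto (fun h : ℝ => K * (h / (1 + |c|)) ^ (-(p / 2))) atTop (𝓝 0) := by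
    simpa using ((tendsto_rpow_neg_atTop (half_pos hf.pos)).comp
      (tendsto_id.atTop_div_const (by positivity : 0 < 1 + |c|))).const_mul K
  refine norm_le_zero_iff.1 (ge_of_tendsto hlim ?_)
  filter_upwards [eventually_gt_atTop (max 0 (-c))] with h hh
  have hh₀ := (le_max_left _ _).trans_lt hh
  have hKs := hK s h (by linarith) hh₀
  have hpow : s ^ (-(c + h)) ≤ 1 :=
    Real.rpow_le_one_of_one_le_of_nonpos hs (by linarith [(le_max_right _ _).trans_lt hh])
  have hpos : 0 < s ^ (-(c + h)) := by positivity
  have hnn := nonneg_of_mul_nonneg_right ((norm_nonneg _).trans hKs) hpos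
  exact hKs.trans (mul_le_of_le_one_left hnn hpow)

theorem mellinDensity_eq_zero (hf : IsMellinSymbol f p c) (hs : 1 ≤ s) :
    mellinDensity c f s = 0 := by
  rw [mellinDensity, hf.mellinInv_fwdDiff_eq_zero hs, zero_div]

/-- The line of integration is moved to distance `1 / log (1 / s)` from `re w = c`, where `s ^ (-w)`
has not yet grown by more than a constant factor. -/
theorem exists_norm_mellinDensity_le (hf : IsMellinSymbol f p c) (hε : 0 < ε) (hεp : ε < p) :
    ∃ K : ℝ, ∀ s ∈ Set.Ioo (0 : ℝ) 1,
      ‖mellinDensity c f s‖ ≤ K * (s ^ (-c - ε) * (1 - s) ^ (ε - 1)) := by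
  obtain ⟨K, hK⟩ := hf.exists_norm_mellinInv_fwdDiff_le hε hεp
  refine ⟨Real.exp 1 * |K| * (1 + |c|) ^ ε, fun s ⟨hs₀, hs₁⟩ => ?_⟩
  have hlog : 0 < -Real.log s := neg_pos.2 (Real.log_neg hs₀ hs₁)
  have hlog_le : -Real.log s ≤ (1 - s) / s := by
    have := Real.one_sub_inv_le_log_of_pos hs₀
    rw [sub_div, div_self hs₀.ne', one_div]
    linarith
  have hexp : s ^ (-(c + (-Real.log s)⁻¹)) = s ^ (-c) * Real.exp 1 := by
    rw [neg_add, Real.rpow_add hs₀, Real.rpow_def_of_pos hs₀ (-(-Real.log s)⁻¹), mul_neg,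
      ← neg_mul, mul_inv_cancel₀ hlog.ne']
  have hrpow : ((-Real.log s)⁻¹ / (1 + |c|)) ^ (-ε) ≤ (1 + |c|) ^ ε * ((1 - s) ^ ε * s ^ (-ε)) := by
    rw [Real.rpow_neg (by positivity), ← Real.inv_rpow (by positivity), inv_div, div_inv_eq_mul,
      Real.mul_rpow (by positivity) hlog.le, Real.rpow_neg hs₀.le, ← div_eq_mul_inv,
      ← Real.div_rpow (by linarith) hs₀.le]
    gcongr
  have hden : ‖(s : ℂ) - 1‖ = 1 - s := by
    rw [← norm_neg, neg_sub, ← ofReal_one, ← ofReal_sub, norm_real, Real.norm_of_nonneg]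
    linarith
  rw [mellinDensity, norm_div, hden, div_le_iff₀ (by linarith)]
  calc _ ≤ _ := hK s _ hs₀ (inv_pos.2 hlog)
    _ ≤ s ^ (-c) * Real.exp 1 * (|K| * ((1 + |c|) ^ ε * ((1 - s) ^ ε * s ^ (-ε)))) := by
      rw [hexp]
      gcongr
      exact le_abs_self K
    _ = _ := by
      rw [sub_eq_add_neg (-c), Real.rpow_add hs₀, Real.rpow_sub_one (by linarith)]
      have : 1 - s ≠ 0 := by linarith
      field_simp

end IsMellinSymbol

end MellinDensity

section MellinInversion

open Complex
open scoped FourierTransform fwdDiff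

variable {E : Type*} [NormedAddCommGroup E] [NormedSpace ℂ E]

theorem mellinConvergent_iff_integrable_exp {f : ℝ → E} {w : ℂ} :
    MellinConvergent f w ↔ Integrable fun u : ℝ => exp (-w * u) • f (Real.exp (-u)) := by
  have hrange : (fun u : ℝ => Real.exp (-u)) '' Set.univ = Set.Ioi 0 := by
    rw [Set.image_univ, ← Real.range_exp]
    exact neg_surjective.range_comp Real.exp
  have hderiv : ∀ u ∈ Set.univ,
      HasDerivWithinAt (fun u : ℝ => Real.exp (-u)) (-Real.exp (-u)) Set.univ u := fun u _ => by
    simpa using (hasDerivAt_neg u).exp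
  rw [MellinConvergent, ← hrange, integrableOn_image_iff_integrableOn_abs_deriv_smul
    MeasurableSet.univ hderiv (Real.exp_injective.comp neg_injective).injOn, integrableOn_univ]
  refine integrable_congr (Eventually.of_forall fun u => ?_)
  have hexp : (Real.exp (-u) : ℂ) = exp (-u) := by push_cast; rfl
  have hlog : log (exp (-(u : ℂ))) = -u := by
    rw [← ofReal_neg, ← ofReal_exp, ← ofReal_log (Real.exp_pos _).le, Real.log_exp]
  simp only [abs_neg, Real.abs_exp]
  rw [← Complex.coe_smul, smul_smul, hexp, cpow_def_of_ne_zero (exp_ne_zero _), hlog, ← exp_add]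
  ring_nf

theorem exp_smul_mellinInv_exp_neg (σ : ℝ) (f : ℂ → E) (u : ℝ) :
    exp (-(σ : ℂ) * u) • mellinInv σ f (Real.exp (-u)) =
      𝓕⁻ (fun y : ℝ => f (σ + 2 * Real.pi * y * I)) u := by
  rw [mellinInv_eq_fourierInv σ f (Real.exp_pos _), Real.log_exp, neg_neg, smul_smul,
    cpow_def_of_ne_zero (ofReal_ne_zero.2 (Real.exp_pos _).ne'), ← ofReal_log (Real.exp_pos _).le,
    Real.log_exp, ← exp_add, ofReal_neg]
  ring_nf
  simp

theorem mellin_mellinInv_eq [CompleteSpace E] {f : ℂ → E} {w : ℂ}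
    (hf : VerticalIntegrable f w.re) (hFf : MellinConvergent (mellinInv w.re f) w.re)
    (hfw : ContinuousAt f w) : mellin (mellinInv w.re f) w = f w := by
  set g : ℝ → E := fun y => f (w.re + 2 * Real.pi * y * I) with hg_def
  have h2π : 2 * Real.pi ≠ 0 := by positivity
  have hgw : (w.re : ℂ) + 2 * Real.pi * (w.im / (2 * Real.pi) : ℝ) * I = w := by
    have : (2 * Real.pi : ℂ) ≠ 0 := by exact_mod_cast h2π
    push_cast
    rw [mul_div_cancel₀ _ this, re_add_im]
  have hg : Integrable g := by
    simpa [hg_def, mul_comm, mul_assoc, mul_left_comm] using hf.comp_mul_right' h2π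
  have hFinv : Integrable (𝓕⁻ g) := by
    simpa only [exp_smul_mellinInv_exp_neg] using mellinConvergent_iff_integrable_exp.1 hFf
  have hF : Integrable (𝓕 g) := by
    simpa only [Real.fourierInv_eq_fourier_neg, neg_neg] using hFinv.comp_neg
  have hcont : ContinuousAt g (w.im / (2 * Real.pi)) :=
    ContinuousAt.comp (g := f) (by rwa [hgw]) (by fun_prop)
  have hcongr : (fun u : ℝ => Real.exp (-w.re * u) • mellinInv w.re f (Real.exp (-u))) = 𝓕⁻ g :=
    funext fun u => by
      rw [hg_def, ← exp_smul_mellinInv_exp_neg, ← Complex.coe_smul]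
      push_cast
      rfl
  calc mellin (mellinInv w.re f) w
      = 𝓕 (𝓕⁻ g) (w.im / (2 * Real.pi)) := by rw [mellin_eq_fourier, hcongr]
    _ = g (w.im / (2 * Real.pi)) := hg.fourier_fourierInv_eq hF hcont
    _ = f w := by rw [hg_def]; exact congrArg f hgw

end MellinInversion

section MellinDensityTransform

open Complex Bornology
open scoped fwdDiff

variable {E : Type*} [NormedAddCommGroup E] [NormedSpace ℂ E]

theorem integrableOn_rpow_mul_one_sub_rpow {u v : ℝ} (hu : 0 < u) (hv : 0 < v) :
    IntegrableOn (fun s : ℝ => s ^ (u - 1) * (1 - s) ^ (v - 1)) (Set.Ioo 0 1) := by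
  have h := (betaIntegral_convergent (u := u) (v := v) (by simpa) (by simpa)).norm
  rw [intervalIntegrable_iff_integrableOn_Ioo_of_le zero_le_one] at h
  refine h.congr_fun (fun s hs => ?_) measurableSet_Ioo
  have hs₁ : (1 : ℂ) - s = ((1 - s : ℝ) : ℂ) := by push_cast; rfl
  simp only [norm_mul]
  rw [hs₁, norm_cpow_eq_rpow_re_of_pos hs.1, norm_cpow_eq_rpow_re_of_pos (by linarith [hs.2])]
  simp

theorem tendsto_integral_pow_smul {g : ℝ → E} (hg : IntegrableOn g (Set.Ioo 0 1)) :
    Tendsto (fun n : ℕ => ∫ s in Set.Ioo (0 : ℝ) 1, (s : ℂ) ^ n • g s) atTop (𝓝 0) := by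
  have hlim := tendsto_integral_of_dominated_convergence
    (F := fun (n : ℕ) (s : ℝ) => (s : ℂ) ^ n • g s) (f := fun _ => 0)
    (μ := volume.restrict (Set.Ioo (0 : ℝ) 1)) (fun s => ‖g s‖)
    (fun n => (by fun_prop : Continuous fun s : ℝ => (s : ℂ) ^ n).aestronglyMeasurable.smul
      hg.aestronglyMeasurable) hg.norm (fun n => ?_) ?_
  · simpa using hlim
  · filter_upwards [ae_restrict_mem measurableSet_Ioo] with s hs
    rw [norm_smul, norm_pow, norm_real, Real.norm_of_nonneg hs.1.le]
    exact mul_le_of_le_one_left (norm_nonneg _) (pow_le_one₀ hs.1.le hs.2.le)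
  · filter_upwards [ae_restrict_mem measurableSet_Ioo] with s hs
    have hs₁ : ‖(s : ℂ)‖ < 1 := by rw [norm_real, Real.norm_of_nonneg hs.1.le]; exact hs.2
    simpa using (tendsto_pow_atTop_nhds_zero_of_norm_lt_one hs₁).smul_const (g s)

section Support

variable {D : ℝ → E} {w : ℂ}

theorem mellinConvergent_iff_integrableOn_Ioo (hD : ∀ s, 1 ≤ s → D s = 0) :
    MellinConvergent D w ↔ IntegrableOn (fun s : ℝ => (s : ℂ) ^ (w - 1) • D s) (Set.Ioo 0 1) :=
  ⟨fun h => h.mono_set Set.Ioo_subset_Ioi_self,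
    fun h => h.of_forall_sdiff_eq_zero measurableSet_Ioi fun s hs => by
      rw [hD s (not_lt.1 fun h' => hs.2 ⟨hs.1, h'⟩), smul_zero]⟩

theorem mellin_eq_integral_Ioo (hD : ∀ s, 1 ≤ s → D s = 0) :
    mellin D w = ∫ s in Set.Ioo (0 : ℝ) 1, (s : ℂ) ^ (w - 1) • D s :=
  setIntegral_eq_of_subset_of_forall_sdiff_eq_zero measurableSet_Ioi Set.Ioo_subset_Ioi_self
    fun s hs => by rw [hD s (not_lt.1 fun h' => hs.2 ⟨hs.1, h'⟩), smul_zero]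

theorem tendsto_mellin_add_natCast (hD : ∀ s, 1 ≤ s → D s = 0) (hDw : MellinConvergent D w) :
    Tendsto (fun n : ℕ => mellin D (w + n)) atTop (𝓝 0) := by
  refine (tendsto_integral_pow_smul ((mellinConvergent_iff_integrableOn_Ioo hD).1 hDw)).congr
    fun n => ?_
  rw [mellin_eq_integral_Ioo hD]
  refine setIntegral_congr_fun measurableSet_Ioo fun s hs => ?_
  rw [smul_smul, ← cpow_natCast, ← cpow_add _ _ (ofReal_ne_zero.2 hs.1.ne'),
    show (n : ℂ) + (w - 1) = w + n - 1 by ring]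

end Support

namespace IsMellinSymbol

variable {f : ℂ → ℂ} {p c s : ℝ} {w : ℂ}

theorem mellinConvergent_mellinDensity (hf : IsMellinSymbol f p c) (hw : c < w.re) :
    MellinConvergent (mellinDensity c f) w := by
  obtain ⟨ε, hε, hε'⟩ := exists_between (lt_min hf.pos (sub_pos.2 hw))
  obtain ⟨hεp, hεw⟩ := lt_min_iff.1 hε'
  obtain ⟨K, hK⟩ := hf.exists_norm_mellinDensity_le hε hεp
  rw [mellinConvergent_iff_integrableOn_Ioo fun s => hf.mellinDensity_eq_zero]
  have hmeas : Measurable fun s : ℝ => (s : ℂ) ^ (w - 1) • mellinDensity c f s :=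
    (by fun_prop : Measurable fun s : ℝ => (s : ℂ)).pow_const _ |>.smul
      ((stronglyMeasurable_mellinInv (hf.continuous_fwdDiff_vertical le_rfl)).measurable.div
        (by fun_prop))
  refine ((integrableOn_rpow_mul_one_sub_rpow (u := w.re - c - ε) (by linarith) hε).const_mul
    K).mono' hmeas.aestronglyMeasurable ?_
  filter_upwards [ae_restrict_mem measurableSet_Ioo] with s hs
  have hrpow : s ^ (w.re - c - ε - 1) = s ^ (w.re - 1) * s ^ (-c - ε) := by
    rw [← Real.rpow_add hs.1]
    ring_nf
  have hnorm : ‖(s : ℂ) ^ (w - 1)‖ = s ^ (w.re - 1) := by simp [norm_cpow_eq_rpow_re_of_pos hs.1]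
  calc ‖(s : ℂ) ^ (w - 1) • mellinDensity c f s‖
      ≤ s ^ (w.re - 1) * (K * (s ^ (-c - ε) * (1 - s) ^ (ε - 1))) := by
        rw [norm_smul, hnorm]
        exact mul_le_mul_of_nonneg_left (hK s hs) (by have := hs.1; positivity)
    _ = _ := by rw [hrpow]; ring

theorem tendsto_add_natCast (hf : IsMellinSymbol f p c) (hw : c ≤ w.re) :
    Tendsto (fun n : ℕ => f (w + n)) atTop (𝓝 0) := by
  refine hf.tendsto_cobounded.comp (tendsto_inf.2 ⟨?_, tendsto_principal.2 ?_⟩)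
  · refine tendsto_norm_atTop_iff_cobounded.1 (tendsto_atTop_mono (fun n : ℕ => ?_)
      (tendsto_atTop_add_const_left _ w.re tendsto_natCast_atTop_atTop))
    simpa using re_le_norm (w + n)
  · exact Eventually.of_forall fun n => by simpa using hw.trans (by simp)

theorem cpow_one_smul_mellinDensity_sub (hf : IsMellinSymbol f p c) (s : ℝ) :
    (s : ℂ) ^ (1 : ℂ) • mellinDensity c f s - mellinDensity c f s = mellinInv c (Δ_[1] f) s := by
  rcases eq_or_ne s 1 with rfl | hs
  · simp [hf.mellinDensity_eq_zero le_rfl, hf.mellinInv_fwdDiff_eq_zero le_rfl]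
  · rw [cpow_one, smul_eq_mul, ← sub_one_mul, mellinDensity,
      mul_div_cancel₀ _ (sub_ne_zero.2 (by exact_mod_cast hs))]

theorem hasMellin_mellinInv_fwdDiff (hf : IsMellinSymbol f p c) (hw : c < w.re) :
    HasMellin (mellinInv c (Δ_[1] f)) w
      (mellin (mellinDensity c f) (w + 1) - mellin (mellinDensity c f) w) := by
  rw [← funext hf.cpow_one_smul_mellinDensity_sub, ← mellin_cpow_smul]
  exact hasMellin_sub (MellinConvergent.cpow_smul.2
    (hf.mellinConvergent_mellinDensity (by simpa using hw.trans (by simp))))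
    (hf.mellinConvergent_mellinDensity hw)

theorem mellin_mellinDensity_add_one_sub (hf : IsMellinSymbol f p c) (hw : c < w.re) :
    mellin (mellinDensity c f) (w + 1) - mellin (mellinDensity c f) w = Δ_[1] f w := by
  have hline : Set.EqOn (mellinInv c (Δ_[1] f)) (mellinInv w.re (Δ_[1] f)) (Set.Ioi 0) :=
    fun s hs => hf.mellinInv_fwdDiff_eq hw.le hs
  have hconv : MellinConvergent (mellinInv w.re (Δ_[1] f)) w.re :=
    (hf.hasMellin_mellinInv_fwdDiff (w := w.re) (by simpa using hw)).1.congr_fun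
      (fun s hs => by simp only [hline hs]) measurableSet_Ioi
  rw [← mellin_mellinInv_eq (hf.verticalIntegrable_fwdDiff hw.le) hconv
    (hf.differentiableAt_fwdDiff hw.le).continuousAt, ← (hf.hasMellin_mellinInv_fwdDiff hw).2]
  exact setIntegral_congr_fun measurableSet_Ioi fun s hs => by simp only [hline hs]

theorem hasMellin_mellinDensity (hf : IsMellinSymbol f p c) (hw : c < w.re) :
    HasMellin (mellinDensity c f) w (f w) := by
  have hconv := hf.mellinConvergent_mellinDensity hw
  refine ⟨hconv, sub_eq_zero.1 ?_⟩
  set d : ℂ → ℂ := fun w => mellin (mellinDensity c f) w - f w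
  have hperiodic : ∀ n : ℕ, d (w + n) = d w := fun n => by
    induction n with
    | zero => simp
    | succ n ih =>
      have hn : c < (w + n).re := hw.trans_le (by simp)
      have := hf.mellin_mellinDensity_add_one_sub hn
      rw [fwdDiff] at this
      rw [← ih, Nat.cast_succ, ← add_assoc]
      linear_combination this
  have hlim := (tendsto_mellin_add_natCast (fun s => hf.mellinDensity_eq_zero) hconv).sub
    (hf.tendsto_add_natCast hw.le)
  rw [sub_zero] at hlim
  exact tendsto_nhds_unique (tendsto_const_nhds.congr fun n => (hperiodic n).symm) hlim

theorem mellinInvTrunc_fwdDiff (hf : IsMellinSymbol f p c) (hs : 0 < s) (R : ℝ) :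
    mellinInvTrunc c (Δ_[1] f) s R =
      s * mellinInvTrunc (c + 1) f s R - mellinInvTrunc c f s R := by
  have hint : ∀ c', c ≤ c' → IntervalIntegrable
      (fun y : ℝ => (s : ℂ) ^ (-((c' : ℂ) + y * I)) • f (c' + y * I)) volume (-R) R := fun c' hc =>
    ((continuous_ofReal_cpow_neg_add_mul_I hs c').smul
      (hf.continuous_vertical hc)).intervalIntegrable _ _
  simp only [mellinInvTrunc]
  rw [mul_smul_comm, ← smul_sub, ← intervalIntegral.integral_const_mul,
    ← intervalIntegral.integral_sub ((hint (c + 1) (by linarith)).const_mul _) (hint c le_rfl)]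
  congr 2 with y
  have hcpow : (s : ℂ) ^ (-((c : ℂ) + y * I)) = s * (s : ℂ) ^ (-(((c + 1 : ℝ) : ℂ) + y * I)) := by
    nth_rewrite 2 [← cpow_one (s : ℂ)]
    rw [← cpow_add _ _ (ofReal_ne_zero.2 hs.ne')]
    push_cast
    ring_nf
  have harg : ((c + 1 : ℝ) : ℂ) + y * I = c + y * I + 1 := by push_cast; ring
  rw [smul_eq_mul, smul_eq_mul, smul_eq_mul, fwdDiff, mul_sub, ← harg, hcpow, mul_assoc]

theorem tendsto_mellinInvTrunc_mellinDensity (hf : IsMellinSymbol f p c) (hs : 0 < s)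
    (hs₁ : s ≠ 1) : Tendsto (mellinInvTrunc c f s) atTop (𝓝 (mellinDensity c f s)) := by
  have hshift := tendsto_mellinInvTrunc_sub (c₁ := c) (c₂ := c + 1) (f := f) (by linarith) hs
    (fun _ hw => (hf.differentiableAt _ hw.1).differentiableWithinAt)
    (hf.tendsto_cobounded.mono_left (inf_le_inf_left _ (principal_mono.2 fun _ hw => hw.1)))
  have h := ((tendsto_mellinInvTrunc hs (hf.verticalIntegrable_fwdDiff le_rfl)).sub
    (hshift.const_mul (s : ℂ))).div_const ((s : ℂ) - 1)
  rw [mul_zero, sub_zero] at h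
  have hne : (s : ℂ) - 1 ≠ 0 := sub_ne_zero.2 (by exact_mod_cast hs₁)
  refine h.congr fun R => ?_
  rw [hf.mellinInvTrunc_fwdDiff hs, div_eq_iff hne]
  ring

end IsMellinSymbol

end MellinDensityTransform

/-! ### Moments on the unit interval -/

section Moments

variable {E : Type*} [NormedAddCommGroup E] [NormedSpace ℝ E] {x y : ℝ} {g : ℝ → E}

theorem integral_polynomial_smul_eq_zero (hg : IntegrableOn g (Set.Icc x y))
    (h : ∀ n : ℕ, ∫ s in Set.Icc x y, s ^ n • g s = 0) (P : Polynomial ℝ) :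
    ∫ s in Set.Icc x y, P.eval s • g s = 0 := by
  have hpow (n : ℕ) : IntegrableOn (fun s => s ^ n • g s) (Set.Icc x y) :=
    hg.continuousOn_smul (continuousOn_pow n) isCompact_Icc
  simp only [Polynomial.eval_eq_sum_range, Finset.sum_smul, mul_smul]
  rw [integral_finsetSum _ fun n _ => (hpow n).fun_smul (P.coeff n)]
  simp only [integral_smul, h, smul_zero, Finset.sum_const_zero]

theorem integral_continuous_smul_eq_zero (hg : IntegrableOn g (Set.Icc x y))
    (h : ∀ n : ℕ, ∫ s in Set.Icc x y, s ^ n • g s = 0) {φ : ℝ → ℝ} (hφ : Continuous φ) :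
    ∫ s in Set.Icc x y, φ s • g s = 0 := by
  have hint {φ : ℝ → ℝ} (hφ : Continuous φ) : IntegrableOn (fun s => φ s • g s) (Set.Icc x y) :=
    hg.continuousOn_smul hφ.continuousOn isCompact_Icc
  have happrox {ε : ℝ} (hε : 0 < ε) :
      ‖∫ s in Set.Icc x y, φ s • g s‖ ≤ ε * ∫ s in Set.Icc x y, ‖g s‖ := by
    obtain ⟨P, hP⟩ := exists_polynomial_near_of_continuousOn x y φ hφ.continuousOn ε hε
    calc ‖∫ s in Set.Icc x y, φ s • g s‖
        = ‖∫ s in Set.Icc x y, (φ s • g s - P.eval s • g s)‖ := by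
          rw [integral_sub (hint hφ) (hint P.continuous), integral_polynomial_smul_eq_zero hg h,
            sub_zero]
      _ ≤ ∫ s in Set.Icc x y, ε * ‖g s‖ := by
          refine norm_integral_le_of_norm_le (hg.norm.const_mul ε) ?_
          filter_upwards [ae_restrict_mem measurableSet_Icc] with s hs
          rw [← sub_smul, norm_smul, Real.norm_eq_abs, abs_sub_comm]
          exact mul_le_mul_of_nonneg_right (hP s hs).le (norm_nonneg _)
      _ = ε * ∫ s in Set.Icc x y, ‖g s‖ := integral_const_mul _ _
  have hlim : Tendsto (fun ε : ℝ => ε * ∫ s in Set.Icc x y, ‖g s‖) (𝓝[>] 0) (𝓝 0) := by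
    have hcont : Continuous fun ε : ℝ => ε * ∫ s in Set.Icc x y, ‖g s‖ := by fun_prop
    simpa using (hcont.tendsto 0).mono_left nhdsWithin_le_nhds
  exact norm_le_zero_iff.1 <|
    ge_of_tendsto hlim (eventually_nhdsWithin_of_forall fun ε hε => happrox hε)

theorem ae_eq_zero_of_forall_integral_pow_smul_eq_zero [CompleteSpace E]
    (hg : IntegrableOn g (Set.Icc x y))
    (h : ∀ n : ℕ, ∫ s in Set.Icc x y, s ^ n • g s = 0) :
    g =ᵐ[volume.restrict (Set.Icc x y)] 0 := by
  rw [EventuallyEq, ae_restrict_iff' measurableSet_Icc]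
  have hloc := (hg.integrable_indicator measurableSet_Icc).locallyIntegrable
  filter_upwards [ae_eq_zero_of_integral_contDiff_smul_eq_zero hloc fun φ hφ _ => by
    simpa only [← Set.indicator_smul, integral_indicator measurableSet_Icc] using
      integral_continuous_smul_eq_zero hg h hφ.continuous] with s hs hsxy
  rwa [Set.indicator_of_mem hsxy] at hs

end Moments

section UnitMellin

open Complex

/-- The Cauchy estimate turns the bound on `F` into the bound on its derivative. -/
theorem differentiableAt_integral_of_norm_le {α E : Type*} [MeasurableSpace α] {μ : Measure α}
    [NormedAddCommGroup E] [NormedSpace ℂ E] {F : ℂ → α → E} {bound : α → ℝ} {U : Set ℂ} {z₀ : ℂ}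
    (hU : U ∈ 𝓝 z₀) (hF_meas : ∀ z, AEStronglyMeasurable (F z) μ)
    (hF_le : ∀ᵐ x ∂μ, ∀ z ∈ U, ‖F z x‖ ≤ bound x) (hbound : Integrable bound μ)
    (hF_diff : ∀ᵐ x ∂μ, ∀ z ∈ U, DifferentiableAt ℂ (F · x) z) :
    DifferentiableAt ℂ (fun z => ∫ x, F z x ∂μ) z₀ := by
  obtain ⟨r, hr, hrU⟩ := Metric.nhds_basis_closedBall.mem_iff.1 hU
  have hz₀ : z₀ ∈ U := mem_of_mem_nhds hU
  have hsub {z : ℂ} (hz : z ∈ Metric.ball z₀ (r / 2)) : Metric.closedBall z (r / 2) ⊆ U :=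
    (Metric.closedBall_subset_closedBall' (by linarith [Metric.mem_ball.1 hz])).trans hrU
  have hderiv_meas : AEStronglyMeasurable (fun x => deriv (F · x) z₀) μ := by
    refine aestronglyMeasurable_of_tendsto_ae (𝓝[≠] z₀) (f := fun z x => slope (F · x) z₀ z)
      (fun z => ((hF_meas z).sub (hF_meas z₀)).const_smul _) ?_
    filter_upwards [hF_diff] with x hx
    exact (hx z₀ hz₀).hasDerivAt.tendsto_slope
  refine (hasDerivAt_integral_of_dominated_loc_of_deriv_le (F' := fun z x => deriv (F · x) z)
    (bound := fun x => bound x / (r / 2)) (Metric.ball_mem_nhds z₀ (half_pos hr))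
    (Eventually.of_forall hF_meas) ?_ hderiv_meas ?_ (hbound.div_const _) ?_).2.differentiableAt
  · exact hbound.mono' (hF_meas z₀) (hF_le.mono fun x hx => hx z₀ hz₀)
  · filter_upwards [hF_le, hF_diff] with x hle hdiff z hz
    refine norm_deriv_le_of_forall_mem_sphere_norm_le (half_pos hr) ?_ fun u hu =>
      hle u (hsub hz (Metric.sphere_subset_closedBall hu))
    exact DifferentiableOn.diffContOnCl_ball
      (fun u hu => (hdiff u (hsub hz hu)).differentiableWithinAt) subset_rfl
  · filter_upwards [hF_diff] with x hx z hz
    exact (hx z (hsub hz (Metric.mem_closedBall_self (half_pos hr).le))).hasDerivAt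

/-- The Mellin transform `∫₀¹ s ^ w ρ(s) ds` over the unit interval; the exponent is `w` and not
`w - 1`, so that the values at the natural numbers are the moments of `ρ`. -/
noncomputable def unitMellin {E : Type*} [NormedAddCommGroup E] [NormedSpace ℂ E] (ρ : ℝ → E)
    (w : ℂ) : E :=
  ∫ s in Set.Ioo (0 : ℝ) 1, (s : ℂ) ^ w • ρ s

variable {E : Type*} [NormedAddCommGroup E] [NormedSpace ℂ E] {ρ ρ₁ ρ₂ : ℝ → E}

theorem aestronglyMeasurable_cpow_smul (hρ : IntegrableOn ρ (Set.Ioo 0 1)) (w : ℂ) :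
    AEStronglyMeasurable (fun s : ℝ => (s : ℂ) ^ w • ρ s) (volume.restrict (Set.Ioo 0 1)) :=
  (measurable_ofReal.pow_const w).aestronglyMeasurable.smul hρ.aestronglyMeasurable

theorem ae_forall_norm_cpow_smul_le (ρ : ℝ → E) :
    ∀ᵐ s : ℝ ∂volume.restrict (Set.Ioo 0 1), ∀ w : ℂ, 0 ≤ w.re → ‖(s : ℂ) ^ w • ρ s‖ ≤ ‖ρ s‖ := by
  filter_upwards [ae_restrict_mem measurableSet_Ioo] with s hs w hw
  rw [norm_smul, norm_cpow_eq_rpow_re_of_pos hs.1]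
  exact mul_le_of_le_one_left (norm_nonneg _) (Real.rpow_le_one hs.1.le hs.2.le hw)

theorem ae_differentiable_cpow_smul (ρ : ℝ → E) :
    ∀ᵐ s : ℝ ∂volume.restrict (Set.Ioo 0 1), Differentiable ℂ fun w : ℂ => (s : ℂ) ^ w • ρ s := by
  filter_upwards [ae_restrict_mem measurableSet_Ioo] with s hs
  have hs₀ : (s : ℂ) ≠ 0 := ofReal_ne_zero.2 hs.1.ne'
  exact (differentiable_id.const_cpow (Or.inl hs₀)).smul_const (ρ s)

theorem continuousOn_unitMellin (hρ : IntegrableOn ρ (Set.Ioo 0 1)) :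
    ContinuousOn (unitMellin ρ) {w | 0 ≤ w.re} := by
  refine continuousOn_of_dominated (fun w _ => aestronglyMeasurable_cpow_smul hρ w)
    (fun w hw => (ae_forall_norm_cpow_smul_le ρ).mono fun _ hs => hs w hw) hρ.norm ?_
  filter_upwards [ae_differentiable_cpow_smul ρ] with s hs
  exact hs.continuous.continuousOn

theorem differentiableOn_unitMellin (hρ : IntegrableOn ρ (Set.Ioo 0 1)) :
    DifferentiableOn ℂ (unitMellin ρ) {w | 0 < w.re} := fun w hw => by
  refine (differentiableAt_integral_of_norm_le
    ((isOpen_lt continuous_const continuous_re).mem_nhds hw)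
    (aestronglyMeasurable_cpow_smul hρ) ?_ hρ.norm ?_).differentiableWithinAt
  · exact (ae_forall_norm_cpow_smul_le ρ).mono fun s hs u hu => hs u (le_of_lt hu)
  · exact (ae_differentiable_cpow_smul ρ).mono fun s hs u _ => hs u

theorem unitMellin_natCast (ρ : ℝ → E) (n : ℕ) :
    unitMellin ρ n = ∫ s in Set.Ioo (0 : ℝ) 1, (s : ℂ) ^ n • ρ s := by
  simp only [unitMellin, cpow_natCast]

theorem integrableOn_cpow_smul (hρ : IntegrableOn ρ (Set.Ioo 0 1)) {w : ℂ} (hw : 0 ≤ w.re) :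
    IntegrableOn (fun s : ℝ => (s : ℂ) ^ w • ρ s) (Set.Ioo 0 1) :=
  Integrable.mono hρ (aestronglyMeasurable_cpow_smul hρ w)
    ((ae_forall_norm_cpow_smul_le ρ).mono fun _ hs => hs w hw)

theorem unitMellin_congr_ae (h : ρ₁ =ᵐ[volume.restrict (Set.Ioo 0 1)] ρ₂) :
    unitMellin ρ₁ = unitMellin ρ₂ :=
  funext fun _ => integral_congr_ae (h.mono fun _ hs => congrArg (_ • ·) hs)

theorem unitMellin_sub (h₁ : IntegrableOn ρ₁ (Set.Ioo 0 1)) (h₂ : IntegrableOn ρ₂ (Set.Ioo 0 1))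
    {w : ℂ} (hw : 0 ≤ w.re) : unitMellin (ρ₁ - ρ₂) w = unitMellin ρ₁ w - unitMellin ρ₂ w := by
  simp only [unitMellin, Pi.sub_apply, smul_sub]
  exact integral_sub (integrableOn_cpow_smul h₁ hw) (integrableOn_cpow_smul h₂ hw)

theorem unitMellin_pow_smul (ρ : ℝ → E) (n : ℕ) (w : ℂ) :
    unitMellin (fun s => (s : ℂ) ^ n • ρ s) w = unitMellin ρ (w + n) := by
  refine setIntegral_congr_fun measurableSet_Ioo fun s hs => ?_
  rw [smul_smul, cpow_add _ _ (ofReal_ne_zero.2 hs.1.ne'), cpow_natCast]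

theorem tendsto_unitMellin_natCast (hρ : IntegrableOn ρ (Set.Ioo 0 1)) :
    Tendsto (fun n : ℕ => unitMellin ρ n) atTop (𝓝 0) := by
  simpa only [unitMellin_natCast] using tendsto_integral_pow_smul hρ

theorem ae_eq_of_forall_unitMellin_natCast_eq [CompleteSpace E]
    (h₁ : IntegrableOn ρ₁ (Set.Ioo 0 1)) (h₂ : IntegrableOn ρ₂ (Set.Ioo 0 1))
    (h : ∀ n : ℕ, unitMellin ρ₁ n = unitMellin ρ₂ n) :
    ρ₁ =ᵐ[volume.restrict (Set.Ioo 0 1)] ρ₂ := by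
  rw [restrict_Ioo_eq_restrict_Icc, ← sub_ae_eq_zero]
  refine ae_eq_zero_of_forall_integral_pow_smul_eq_zero
    ((integrableOn_Icc_iff_integrableOn_Ioo).2 (h₁.sub h₂)) fun n => ?_
  have hn : unitMellin (ρ₁ - ρ₂) n = 0 := by rw [unitMellin_sub h₁ h₂ (by simp), h, sub_self]
  rw [integral_Icc_eq_integral_Ioo, ← hn, unitMellin_natCast]
  simp only [← ofReal_pow, coe_smul]

theorem ae_eq_of_forall_unitMellin_natCast_add_eq [CompleteSpace E] (N : ℕ)
    (h₁ : IntegrableOn (fun s : ℝ => (s : ℂ) ^ N • ρ₁ s) (Set.Ioo 0 1))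
    (h₂ : IntegrableOn (fun s : ℝ => (s : ℂ) ^ N • ρ₂ s) (Set.Ioo 0 1))
    (h : ∀ n : ℕ, unitMellin ρ₁ (n + N) = unitMellin ρ₂ (n + N)) :
    ρ₁ =ᵐ[volume.restrict (Set.Ioo 0 1)] ρ₂ := by
  filter_upwards [ae_restrict_mem measurableSet_Ioo,
    ae_eq_of_forall_unitMellin_natCast_eq h₁ h₂ fun n => by simp only [unitMellin_pow_smul, h]]
    with s hs hs_eq
  exact smul_right_injective E (pow_ne_zero N (ofReal_ne_zero.2 hs.1.ne')) hs_eq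

end UnitMellin

/-! ### The hypergeometric function as a Stieltjes transform -/

section HypergeometricSeries

open Complex

theorem eq_of_eventually_hasSum_mul_pow {𝕜 : Type*} [NontriviallyNormedField 𝕜] {u v : ℕ → 𝕜}
    {f : 𝕜 → 𝕜} (hu : ∀ᶠ z in 𝓝 0, HasSum (fun n => u n * z ^ n) (f z))
    (hv : ∀ᶠ z in 𝓝 0, HasSum (fun n => v n * z ^ n) (f z)) : u = v := by
  have hasFPowerSeriesAt {w : ℕ → 𝕜} (hw : ∀ᶠ z in 𝓝 0, HasSum (fun n => w n * z ^ n) (f z)) :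
      HasFPowerSeriesAt f (.ofScalars 𝕜 w) 0 :=
    hasFPowerSeriesAt_iff.2 (by simpa [mul_comm] using hw)
  exact FormalMultilinearSeries.ofScalars_series_injective 𝕜 𝕜
    ((hasFPowerSeriesAt hu).eq_formalMultilinearSeries (hasFPowerSeriesAt hv))

theorem risingFactorial_succ (x : ℂ) (n : ℕ) :
    risingFactorial x (n + 1) = risingFactorial x n * (x + n) :=
  Finset.prod_range_succ _ _

theorem risingFactorial_eq_zero_iff {x : ℂ} {n : ℕ} :
    risingFactorial x n = 0 ↔ ∃ m < n, x = -m := by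
  simp only [risingFactorial, Finset.prod_eq_zero_iff, Finset.mem_range, add_eq_zero_iff_eq_neg]

theorem risingFactorial_ne_zero {x : ℂ} (hx : ∀ n : ℕ, x ≠ -n) (n : ℕ) :
    risingFactorial x n ≠ 0 := fun h =>
  let ⟨m, _, hm⟩ := risingFactorial_eq_zero_iff.1 h
  hx m hm

theorem ascPochhammer_eval_eq_risingFactorial (x : ℂ) (n : ℕ) :
    (ascPochhammer ℂ n).eval x = risingFactorial x n := by
  induction n with
  | zero => simp [risingFactorial]
  | succ n ih => rw [ascPochhammer_succ_eval, ih, risingFactorial_succ]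

theorem ringChoose_eq_risingFactorial_div (σ : ℂ) (n : ℕ) :
    Ring.choose (σ + n - 1) n = risingFactorial σ n / n.factorial := by
  rw [eq_div_iff (Nat.cast_ne_zero.2 n.factorial_ne_zero), mul_comm, ← nsmul_eq_mul,
    ← Ring.multichoose_eq, Ring.factorial_nsmul_multichoose_eq_ascPochhammer,
    Polynomial.ascPochhammer_smeval_cast, Polynomial.ascPochhammer_smeval_eq_eval,
    ascPochhammer_eval_eq_risingFactorial]

theorem hasSum_one_sub_cpow_neg (σ : ℂ) {x : ℂ} (hx : ‖x‖ < 1) :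
    HasSum (fun n : ℕ => risingFactorial σ n / n.factorial * x ^ n) ((1 - x) ^ (-σ)) := by
  have h := (one_div_one_sub_cpow_hasFPowerSeriesOnBall_zero σ).hasSum (y := x)
    (by simpa [← ofReal_norm] using hx)
  simpa [ringChoose_eq_risingFactorial_div, mul_comm, cpow_neg] using h

/-- The quotient `(a_1)_n ⋯ (a_q)_n / ((b_1)_n ⋯ (b_q)_n)`, which is the `n`-th moment of a
function representing the hypergeometric function. -/
noncomputable def hypMoment {q : ℕ} (a b : Fin q → ℂ) (n : ℕ) : ℂ :=
  (∏ i, risingFactorial (a i) n) / ∏ i, risingFactorial (b i) n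

variable {q : ℕ}

theorem hypMoment_zero (a b : Fin q → ℂ) : hypMoment a b 0 = 1 := by
  simp [hypMoment, risingFactorial]

theorem hypMoment_succ (a b : Fin q → ℂ) (n : ℕ) :
    hypMoment a b (n + 1) = (∏ i, (a i + n) / (b i + n)) * hypMoment a b n := by
  simp only [hypMoment, risingFactorial_succ, Finset.prod_mul_distrib, Finset.prod_div_distrib]
  rw [mul_div_mul_comm, mul_comm]

theorem tendsto_natCast_add_div_natCast_add (x y : ℂ) :
    Tendsto (fun n : ℕ => (x + n) / (y + n)) atTop (𝓝 1) := by
  simpa using tendsto_add_mul_div_add_mul_atTop_nhds x y 1 (one_ne_zero (α := ℂ))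

theorem hasSum_hypSeries (σ : ℂ) (a b : Fin q → ℂ) {z : ℂ} (hz : ‖z‖ < 1) :
    HasSum (fun n : ℕ => risingFactorial σ n / n.factorial * hypMoment a b n * z ^ n)
      (hypSeries σ a b z) := by
  set f : ℕ → ℂ := fun n => risingFactorial σ n / n.factorial * hypMoment a b n * z ^ n
  set κ : ℕ → ℂ := fun n => (σ + n) / (1 + n) * (∏ i, (a i + n) / (b i + n)) * z
  have hf_succ (n : ℕ) : f (n + 1) = κ n * f n := by
    simp only [f, κ, risingFactorial_succ, hypMoment_succ, Nat.factorial_succ, pow_succ]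
    push_cast
    rw [add_comm (n : ℂ) 1, mul_comm (1 + (n : ℂ)), mul_div_mul_comm]
    ring
  have hκ : Tendsto (fun n => ‖κ n‖) atTop (𝓝 ‖z‖) := by
    simpa [κ] using (((tendsto_natCast_add_div_natCast_add σ 1).mul (tendsto_finsetProd Finset.univ
      fun i _ => tendsto_natCast_add_div_natCast_add (a i) (b i))).mul_const z).norm
  obtain ⟨r, hzr, hr⟩ := exists_between hz
  have hf : Summable f := by
    refine summable_of_ratio_norm_eventually_le hr ?_
    filter_upwards [hκ.eventually_le_const hzr] with n hn
    rw [hf_succ, norm_mul]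
    exact mul_le_mul_of_nonneg_right hn (norm_nonneg _)
  convert hf.hasSum using 1
  refine tsum_congr fun n => ?_
  rw [mul_comm (∏ j, risingFactorial (b j) n), mul_div_mul_comm]
  rfl

end HypergeometricSeries

section StieltjesTransform

open Complex

/-- The generalized Stieltjes transform `∫₀¹ (1 - s z) ^ (-σ) ρ(s) ds`, with the sign of `z`
chosen so that it is holomorphic in `cutPlane`. -/
noncomputable def stieltjesTransform {E : Type*} [NormedAddCommGroup E] [NormedSpace ℂ E] (σ : ℂ)
    (ρ : ℝ → E) (z : ℂ) : E :=
  ∫ s in Set.Ioo (0 : ℝ) 1, (1 - (s : ℂ) * z) ^ (-σ) • ρ s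

variable {E : Type*} [NormedAddCommGroup E] [NormedSpace ℂ E] {ρ : ℝ → E}

theorem hasSum_stieltjesTransform (σ : ℂ) (hρ : IntegrableOn ρ (Set.Ioo 0 1)) {z : ℂ}
    (hz : ‖z‖ < 1) :
    HasSum (fun n : ℕ => (risingFactorial σ n / n.factorial * z ^ n) • unitMellin ρ n)
      (stieltjesTransform σ ρ z) := by
  set κ : ℕ → ℂ := fun n => risingFactorial σ n / n.factorial * z ^ n
  have hκ : Summable fun n => ‖κ n‖ := (hasSum_one_sub_cpow_neg σ hz).summable.norm
  simp only [unitMellin, ← integral_smul]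
  refine hasSum_integral_of_dominated_convergence (fun n s => ‖κ n‖ * ‖ρ s‖)
    (fun n => (aestronglyMeasurable_cpow_smul hρ n).const_smul _) (fun n => ?_)
    (Eventually.of_forall fun s => hκ.mul_right _) ?_ ?_
  · filter_upwards [ae_forall_norm_cpow_smul_le ρ] with s hs
    rw [norm_smul]
    exact mul_le_mul_of_nonneg_left (hs n (by simp)) (norm_nonneg _)
  · simpa only [tsum_mul_right] using hρ.norm.const_mul _
  · filter_upwards [ae_restrict_mem measurableSet_Ioo] with s hs
    have hsz : ‖(s : ℂ) * z‖ < 1 := by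
      rw [norm_mul, norm_real, Real.norm_of_nonneg hs.1.le]
      exact (mul_le_of_le_one_left (norm_nonneg _) hs.2.le).trans_lt hz
    refine ((hasSum_one_sub_cpow_neg σ hsz).smul_const (ρ s)).congr_fun fun n => ?_
    rw [smul_smul, cpow_natCast, mul_pow, mul_assoc, mul_comm (z ^ n)]

theorem isOpen_cutPlane : IsOpen cutPlane :=
  isOpen_slitPlane.preimage (by fun_prop : Continuous fun z : ℂ => 1 - z)

theorem one_sub_mul_mem_slitPlane {z : ℂ} (hz : z ∈ cutPlane) {s : ℝ} (hs : s ∈ Set.Icc 0 1) :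
    1 - (s : ℂ) * z ∈ slitPlane := by
  have h := StarConvex.add_smul_mem (x := (1 : ℂ)) (y := -z) starConvex_one_slitPlane
    (by rw [← sub_eq_add_neg]; exact hz) hs.1 hs.2
  rwa [real_smul, mul_neg, ← sub_eq_add_neg] at h

theorem mem_cutPlane_of_norm_lt_one {z : ℂ} (hz : ‖z‖ < 1) : z ∈ cutPlane := by
  have h := mem_slitPlane_of_norm_lt_one (z := -z) (by rwa [norm_neg])
  rwa [← sub_eq_add_neg] at h

theorem starConvex_cutPlane : StarConvex ℝ 0 cutPlane :=
  starConvex_zero_iff.2 fun _ hz _ h₀ h₁ => by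
    rw [real_smul]
    exact one_sub_mul_mem_slitPlane hz ⟨h₀, h₁⟩

theorem isPreconnected_cutPlane : IsPreconnected cutPlane :=
  (starConvex_cutPlane.isPathConnected
    (mem_cutPlane_of_norm_lt_one (by simp))).isConnected.isPreconnected

theorem differentiableOn_stieltjesTransform (σ : ℂ) (hρ : IntegrableOn ρ (Set.Ioo 0 1)) :
    DifferentiableOn ℂ (stieltjesTransform σ ρ) cutPlane := fun z₀ hz₀ => by
  obtain ⟨r, hr, hball⟩ := Metric.nhds_basis_closedBall.mem_iff.1 (isOpen_cutPlane.mem_nhds hz₀)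
  have hslit {z : ℂ} (hz : z ∈ Metric.closedBall z₀ r) {s : ℝ} (hs : s ∈ Set.Icc 0 1) :
      1 - (s : ℂ) * z ∈ slitPlane := one_sub_mul_mem_slitPlane (hball hz) hs
  have hcont : ContinuousOn (fun x : ℂ × ℝ => (1 - (x.2 : ℂ) * x.1) ^ (-σ))
      (Metric.closedBall z₀ r ×ˢ Set.Icc 0 1) :=
    ContinuousOn.cpow (by fun_prop) continuousOn_const fun x hx => hslit hx.1 hx.2
  obtain ⟨M, hM⟩ :=
    ((isCompact_closedBall z₀ r).prod isCompact_Icc).exists_bound_of_continuousOn hcont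
  refine (differentiableAt_integral_of_norm_le (bound := fun s => M * ‖ρ s‖)
    (Metric.closedBall_mem_nhds z₀ hr) (fun z => ?_) ?_ (hρ.norm.const_mul M)
    ?_).differentiableWithinAt
  · exact (by fun_prop : Measurable fun s : ℝ => (1 - (s : ℂ) * z) ^ (-σ)).aestronglyMeasurable.smul
      hρ.aestronglyMeasurable
  · filter_upwards [ae_restrict_mem measurableSet_Ioo] with s hs z hz
    rw [norm_smul]
    exact mul_le_mul_of_nonneg_right (hM (z, s) ⟨hz, Set.Ioo_subset_Icc_self hs⟩) (norm_nonneg _)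
  · filter_upwards [ae_restrict_mem measurableSet_Ioo] with s hs z hz
    have hlin : DifferentiableAt ℂ (fun z => 1 - (s : ℂ) * z) z := by fun_prop
    exact (hlin.cpow_const (hslit hz (Set.Ioo_subset_Icc_self hs))).smul_const (ρ s)

end StieltjesTransform

section Representation

open Complex

variable {q : ℕ} {σ : ℂ} {a b : Fin q → ℂ} {ρ : ℝ → ℂ}

theorem hypF_eq_hypSeries (σ : ℂ) (a b : Fin q → ℂ) {z : ℂ} (hz : ‖z‖ < 1) :
    hypF σ a b z = hypSeries σ a b z := by
  unfold hypF
  split_ifs with h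
  · exact h.choose_spec.2 z hz
  · rfl

theorem IsHypContinuation.eqOn {f g : ℂ → ℂ} (hf : IsHypContinuation σ a b f)
    (hg : IsHypContinuation σ a b g) : Set.EqOn f g cutPlane := by
  refine (hf.1.analyticOnNhd isOpen_cutPlane).eqOn_of_preconnected_of_eventuallyEq
    (hg.1.analyticOnNhd isOpen_cutPlane) isPreconnected_cutPlane
    (mem_cutPlane_of_norm_lt_one (z := 0) (by simp)) ?_
  filter_upwards [Metric.ball_mem_nhds (0 : ℂ) one_pos] with z hz
  rw [mem_ball_zero_iff] at hz
  rw [hf.2 z hz, hg.2 z hz]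

theorem IsHypContinuation.eqOn_hypF {f : ℂ → ℂ} (hf : IsHypContinuation σ a b f) :
    Set.EqOn (hypF σ a b) f cutPlane := fun z hz => by
  have h : ∃ f : ℂ → ℂ, IsHypContinuation σ a b f := ⟨f, hf⟩
  rw [hypF, dif_pos h]
  exact h.choose_spec.eqOn hf hz

theorem isRepresentedBy_iff_integrableOn_and_eqOn :
    IsRepresentedBy σ a b ρ ↔ IntegrableOn ρ (Set.Ioo 0 1) ∧
      Set.EqOn (hypF σ a b) (stieltjesTransform σ ρ) cutPlane := by
  have hint (z : ℂ) : ∫ s in (0 : ℝ)..1, ρ s / (1 + (s : ℂ) * z) ^ σ =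
      stieltjesTransform σ ρ (-z) := by
    rw [intervalIntegral.integral_of_le zero_le_one, integral_Ioc_eq_integral_Ioo,
      stieltjesTransform]
    simp [cpow_neg, div_eq_inv_mul]
  simp only [IsRepresentedBy, hint]
  rw [integrableOn_Icc_iff_integrableOn_Ioo]
  refine and_congr_right fun _ => ⟨fun h z hz => ?_, fun h z hz => h (by simpa [cutPlane] using hz)⟩
  simpa using h (-z) (by simpa [cutPlane, sub_eq_add_neg] using hz)

/-- `ρ` is summable on `(0, 1)` and its moments are the numbers `hypMoment a b n`. In contrast to
`IsRepresentedBy`, no `σ` is involved. -/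
structure HasHypMoments (a b : Fin q → ℂ) (ρ : ℝ → ℂ) : Prop where
  integrableOn : IntegrableOn ρ (Set.Ioo 0 1)
  unitMellin_eq (n : ℕ) : unitMellin ρ n = hypMoment a b n

theorem HasHypMoments.isRepresentedBy (hρ : HasHypMoments a b ρ) (σ : ℂ) :
    IsRepresentedBy σ a b ρ := by
  have hcont : IsHypContinuation σ a b (stieltjesTransform σ ρ) := by
    refine ⟨differentiableOn_stieltjesTransform σ hρ.integrableOn, fun z hz => ?_⟩
    refine (hasSum_stieltjesTransform σ hρ.integrableOn hz).unique
      ((hasSum_hypSeries σ a b hz).congr_fun fun n => ?_)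
    rw [hρ.unitMellin_eq, smul_eq_mul]
    ring
  exact isRepresentedBy_iff_integrableOn_and_eqOn.2 ⟨hρ.integrableOn, hcont.eqOn_hypF⟩

theorem IsRepresentedBy.hasHypMoments (hσ : ∀ n : ℕ, σ ≠ -n) (hρ : IsRepresentedBy σ a b ρ) :
    HasHypMoments a b ρ := by
  obtain ⟨hint, heq⟩ := isRepresentedBy_iff_integrableOn_and_eqOn.1 hρ
  have hball : ∀ᶠ z : ℂ in 𝓝 0, ‖z‖ < 1 :=
    continuous_norm.tendsto' _ _ norm_zero |>.eventually_lt_const one_pos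
  have hcoeff : (fun n : ℕ => risingFactorial σ n / n.factorial * unitMellin ρ n) =
      fun n : ℕ => risingFactorial σ n / n.factorial * hypMoment a b n := by
    refine eq_of_eventually_hasSum_mul_pow (f := hypSeries σ a b) ?_
      (hball.mono fun z hz => hasSum_hypSeries σ a b hz)
    filter_upwards [hball] with z hz
    rw [← hypF_eq_hypSeries σ a b hz, heq (mem_cutPlane_of_norm_lt_one hz)]
    refine (hasSum_stieltjesTransform σ hint hz).congr_fun fun n => ?_
    rw [smul_eq_mul, mul_right_comm]
  exact ⟨hint, fun n => mul_left_cancel₀ (div_ne_zero (risingFactorial_ne_zero hσ n)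
    (Nat.cast_ne_zero.2 n.factorial_ne_zero)) (congrFun hcoeff n)⟩

theorem HasHypMoments.ae_eq {ρ₁ ρ₂ : ℝ → ℂ} (h₁ : HasHypMoments a b ρ₁)
    (h₂ : HasHypMoments a b ρ₂) : ρ₁ =ᵐ[volume.restrict (Set.Ioo 0 1)] ρ₂ :=
  ae_eq_of_forall_unitMellin_natCast_eq h₁.integrableOn h₂.integrableOn fun n => by
    rw [h₁.unitMellin_eq, h₂.unitMellin_eq]

end Representation

section HypDensity

open Complex
open scoped fwdDiff

variable {q : ℕ} {a b : Fin q → ℂ} {c s : ℝ}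

theorem gammaProd_natCast (ha : ∀ i, ∀ m : ℕ, a i ≠ -m) (hb : ∀ i, ∀ m : ℕ, b i ≠ -m) (n : ℕ) :
    gammaProd a b n = hypMoment a b n * gammaProd a b 0 := by
  simp only [gammaProd, hypMoment, add_zero, Gamma_add_natCast (ha _), Gamma_add_natCast (hb _),
    Finset.prod_mul_distrib, div_mul_div_comm]

theorem gammaProd_zero_ne_zero (ha : ∀ i, ∀ m : ℕ, a i ≠ -m) (hb : ∀ i, ∀ m : ℕ, b i ≠ -m) :
    gammaProd a b 0 ≠ 0 := by
  simp only [gammaProd, add_zero]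
  exact div_ne_zero (Finset.prod_ne_zero_iff.2 fun i _ => Gamma_ne_zero (ha i))
    (Finset.prod_ne_zero_iff.2 fun i _ => Gamma_ne_zero (hb i))

theorem meijerGTrunc_eq_mellinInvTrunc (c : ℝ) (a b : Fin q → ℂ) (s : ℝ) :
    meijerGTrunc c b a s = mellinInvTrunc c (gammaProd a b) s := by
  funext R
  rw [meijerGTrunc, mellinInvTrunc, intervalIntegral.integral_mul_const, real_smul]
  simp only [gammaProd, smul_eq_mul, mul_comm ((s : ℂ) ^ (_ : ℂ))]
  push_cast
  field_simp

theorem tendsto_meijerGTrunc (ha : ∀ i, -(a i).re < c) (hψ : 0 < (hypPsi a b).re) (hs : 0 < s)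
    (hs₁ : s ≠ 1) :
    Tendsto (meijerGTrunc c b a s) atTop (𝓝 (mellinDensity c (gammaProd a b) s)) := by
  rw [meijerGTrunc_eq_mellinInvTrunc]
  exact (isMellinSymbol_gammaProd ha hψ).tendsto_mellinInvTrunc_mellinDensity hs hs₁

theorem meijerG_eq_mellinDensity (ha : ∀ i, -(a i).re < c) (hψ : 0 < (hypPsi a b).re)
    (hs : 0 < s) (hs₁ : s ≠ 1) : meijerG c b a s = mellinDensity c (gammaProd a b) s :=
  (tendsto_meijerGTrunc ha hψ hs hs₁).limUnder_eq

theorem tendsto_meijerGTrunc_meijerG (ha : ∀ i, -(a i).re < c) (hψ : 0 < (hypPsi a b).re)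
    (hs : 0 < s) (hs₁ : s ≠ 1) : Tendsto (meijerGTrunc c b a s) atTop (𝓝 (meijerG c b a s)) :=
  tendsto_nhds_limUnder ⟨_, tendsto_meijerGTrunc ha hψ hs hs₁⟩

theorem cpow_mul_hypDensity_eq (ha : ∀ i, -(a i).re < c) (hψ : 0 < (hypPsi a b).re) (w : ℂ) :
    Set.EqOn (fun s : ℝ => (s : ℂ) ^ w • hypDensity c a b s)
      (fun s => (gammaProd a b 0)⁻¹ • (s : ℂ) ^ (w - 1) • mellinDensity c (gammaProd a b) s)
      (Set.Ioo 0 1) := fun s hs => by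
  simp only [hypDensity, meijerG_eq_mellinDensity ha hψ hs.1 hs.2.ne, smul_eq_mul, gammaProd,
    add_zero, inv_div, Finset.prod_div_distrib, cpow_sub _ _ (ofReal_ne_zero.2 hs.1.ne'), cpow_one]
  ring

theorem integrableOn_cpow_smul_hypDensity (ha : ∀ i, -(a i).re < c) (hψ : 0 < (hypPsi a b).re)
    {w : ℂ} (hw : c < w.re) :
    IntegrableOn (fun s : ℝ => (s : ℂ) ^ w • hypDensity c a b s) (Set.Ioo 0 1) := by
  have hf := isMellinSymbol_gammaProd ha hψ
  refine IntegrableOn.congr_fun ?_ (cpow_mul_hypDensity_eq ha hψ w).symm measurableSet_Ioo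
  exact Integrable.smul (gammaProd a b 0)⁻¹ ((mellinConvergent_iff_integrableOn_Ioo fun _ =>
    hf.mellinDensity_eq_zero).1 (hf.hasMellin_mellinDensity hw).1)

theorem unitMellin_hypDensity (ha : ∀ i, -(a i).re < c) (hψ : 0 < (hypPsi a b).re) {w : ℂ}
    (hw : c < w.re) :
    unitMellin (hypDensity c a b) w = (gammaProd a b 0)⁻¹ * gammaProd a b w := by
  have hf := isMellinSymbol_gammaProd ha hψ
  rw [unitMellin, setIntegral_congr_fun measurableSet_Ioo (cpow_mul_hypDensity_eq ha hψ w),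
    integral_smul, ← mellin_eq_integral_Ioo fun _ => hf.mellinDensity_eq_zero,
    (hf.hasMellin_mellinDensity hw).2, smul_eq_mul]

theorem hypDensity_eqOn_hypDensity {c' : ℝ} (ha : ∀ i, -(a i).re < c) (hcc' : c ≤ c')
    (hψ : 0 < (hypPsi a b).re) :
    Set.EqOn (hypDensity c a b) (hypDensity c' a b) (Set.Ioo 0 1) := fun s hs => by
  rw [hypDensity, hypDensity, meijerG_eq_mellinDensity ha hψ hs.1 hs.2.ne,
    meijerG_eq_mellinDensity (fun i => (ha i).trans_le hcc') hψ hs.1 hs.2.ne, mellinDensity,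
    mellinDensity, (isMellinSymbol_gammaProd ha hψ).mellinInv_fwdDiff_eq hcc' hs.1]

theorem hasHypMoments_hypDensity (ha : ∀ i, 0 < (a i).re) (hb : ∀ i, ∀ m : ℕ, b i ≠ -m)
    (hψ : 0 < (hypPsi a b).re) (hc : ∀ i, -(a i).re < c) :
    HasHypMoments a b (hypDensity c a b) := by
  obtain ⟨d, hd, hdc⟩ : ∃ d, (∀ i, -(a i).re < d) ∧ d < min c 0 := by
    have hev : ∀ᶠ d in 𝓝[<] min c 0, ∀ i, -(a i).re < d := eventually_all.2 fun i =>
      (lt_mem_nhds (lt_min (hc i) (by linarith [ha i]))).filter_mono inf_le_left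
    exact (hev.and self_mem_nhdsWithin).exists
  obtain ⟨hdc, hd₀⟩ := lt_min_iff.1 hdc
  have heq := hypDensity_eqOn_hypDensity hd hdc.le hψ
  have hnat (i) (m : ℕ) : a i ≠ -m := ne_neg_natCast_of_re_pos (ha i) m
  refine ⟨?_, fun n => ?_⟩
  · refine IntegrableOn.congr_fun ?_ heq measurableSet_Ioo
    simpa using integrableOn_cpow_smul_hypDensity hd hψ (w := 0) (by simpa using hd₀)
  · have hn : d < (n : ℂ).re := hd₀.trans_le (by simp)
    rw [← unitMellin_congr_ae (ae_restrict_of_forall_mem measurableSet_Ioo heq),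
      unitMellin_hypDensity hd hψ hn, gammaProd_natCast hnat hb, mul_comm,
      mul_inv_cancel_right₀ (gammaProd_zero_ne_zero hnat hb)]

end HypDensity

section Necessity

open Complex

variable {q : ℕ} {a b : Fin q → ℂ} {ρ : ℝ → ℂ}

theorem tendsto_hypMoment_mul_cpow (ha : ∀ i, ∀ m : ℕ, a i ≠ -m) (b : Fin q → ℂ) :
    Tendsto (fun n : ℕ => hypMoment a b n * (n : ℂ) ^ hypPsi a b) atTop
      (𝓝 (gammaProd a b 0)⁻¹) := by
  have hlim : (gammaProd a b 0)⁻¹ = ∏ i, Gamma (b i) / Gamma (a i) := by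
    simp only [gammaProd, add_zero, inv_div, Finset.prod_div_distrib]
  rw [hlim]
  refine (tendsto_finsetProd Finset.univ fun i _ =>
    tendsto_risingFactorial_div (ha i) (b i)).congr' ?_
  filter_upwards [eventually_ne_atTop 0] with n hn
  have hn₀ : (n : ℂ) ≠ 0 := Nat.cast_ne_zero.2 hn
  rw [Finset.prod_mul_distrib, Finset.prod_div_distrib, hypMoment, hypPsi]
  simp only [cpow_def_of_ne_zero hn₀, Finset.mul_sum, exp_sum]

theorem differentiable_prod_inv_Gamma_add (a : Fin q → ℂ) :
    Differentiable ℂ fun w => ∏ i, (Gamma (a i + w))⁻¹ :=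
  Differentiable.fun_finsetProd fun i _ =>
    differentiable_one_div_Gamma.comp (differentiable_id.const_add (a i))

namespace HasHypMoments

theorem integrableOn_pow_smul (hρ : HasHypMoments a b ρ) (n : ℕ) :
    IntegrableOn (fun s : ℝ => (s : ℂ) ^ n • ρ s) (Set.Ioo 0 1) := by
  simpa only [cpow_natCast] using integrableOn_cpow_smul hρ.integrableOn (w := n) (by simp)

/-- If `a i = -m`, all moments beyond the `m`-th vanish, and hence so does `ρ`. -/
theorem ne_neg_natCast (hρ : HasHypMoments a b ρ) (i : Fin q) (m : ℕ) : a i ≠ -m := fun hi => by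
  have hvanish (n : ℕ) : hypMoment a b (n + (m + 1)) = 0 := by
    have hrf : risingFactorial (a i) (n + (m + 1)) = 0 :=
      risingFactorial_eq_zero_iff.2 ⟨m, by lia, hi⟩
    rw [hypMoment, Finset.prod_eq_zero (Finset.mem_univ i) hrf, zero_div]
  have hzero : ρ =ᵐ[volume.restrict (Set.Ioo 0 1)] 0 :=
    ae_eq_of_forall_unitMellin_natCast_add_eq (m + 1) (hρ.integrableOn_pow_smul _) (by simp)
      fun n => by rw [← Nat.cast_add, hρ.unitMellin_eq, hvanish]; simp [unitMellin]
  have hone := hρ.unitMellin_eq 0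
  rw [unitMellin_congr_ae hzero, hypMoment_zero] at hone
  simp [unitMellin] at hone

theorem hypPsi_re_pos (hρ : HasHypMoments a b ρ) (hb : ∀ i, ∀ m : ℕ, b i ≠ -m) :
    0 < (hypPsi a b).re := by
  by_contra! hψ
  have hmoment : Tendsto (hypMoment a b) atTop (𝓝 0) := by
    simpa only [hρ.unitMellin_eq] using tendsto_unitMellin_natCast hρ.integrableOn
  have hlim : Tendsto (fun n : ℕ => hypMoment a b n * (n : ℂ) ^ hypPsi a b) atTop (𝓝 0) := by
    refine squeeze_zero_norm' ?_ (tendsto_zero_iff_norm_tendsto_zero.1 hmoment)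
    filter_upwards [eventually_gt_atTop 0] with n hn
    rw [norm_mul, norm_natCast_cpow_of_pos hn]
    exact mul_le_of_le_one_right (norm_nonneg _)
      (Real.rpow_le_one_of_one_le_of_nonpos (Nat.one_le_cast.2 hn) hψ)
  exact inv_ne_zero (gammaProd_zero_ne_zero hρ.ne_neg_natCast hb)
    (tendsto_nhds_unique (tendsto_hypMoment_mul_cpow hρ.ne_neg_natCast b) hlim)

theorem ae_eq_hypDensity (hρ : HasHypMoments a b ρ) (hb : ∀ i, ∀ m : ℕ, b i ≠ -m) {c : ℝ}
    (ha : ∀ i, -(a i).re < c) : ρ =ᵐ[volume.restrict (Set.Ioo 0 1)] hypDensity c a b := by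
  have hψ := hρ.hypPsi_re_pos hb
  obtain ⟨N, hN⟩ := exists_nat_gt c
  refine ae_eq_of_forall_unitMellin_natCast_add_eq N (hρ.integrableOn_pow_smul N) ?_ fun n => ?_
  · simpa only [cpow_natCast] using integrableOn_cpow_smul_hypDensity ha hψ (w := N) (by simpa)
  · have hnN : c < ((n + N : ℕ) : ℂ).re := by
      rw [natCast_re, Nat.cast_add]
      linarith [n.cast_nonneg (α := ℝ)]
    rw [← Nat.cast_add, hρ.unitMellin_eq, unitMellin_hypDensity ha hψ hnN,
      gammaProd_natCast hρ.ne_neg_natCast hb, mul_comm,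
      mul_inv_cancel_right₀ (gammaProd_zero_ne_zero hρ.ne_neg_natCast hb)]

theorem eqOn_unitMellin_mul_prod_inv_Gamma (hρ : HasHypMoments a b ρ)
    (hb : ∀ i, ∀ m : ℕ, b i ≠ -m) :
    Set.EqOn (fun w => unitMellin ρ w * ∏ i, (Gamma (a i + w))⁻¹)
      (fun w => (gammaProd a b 0)⁻¹ * ∏ i, (Gamma (b i + w))⁻¹) {w | 0 < w.re} := by
  have hopen : IsOpen {w : ℂ | 0 < w.re} := isOpen_lt continuous_const continuous_re
  obtain ⟨c, hc, ha⟩ : ∃ c : ℝ, 0 < c ∧ ∀ i, -(a i).re < c :=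
    ((eventually_gt_atTop 0).and (eventually_all.2 fun i => eventually_gt_atTop _)).exists
  have hright : ∀ᶠ w in 𝓝 ((c + 1 : ℝ) : ℂ), c < w.re :=
    continuous_re.continuousAt.eventually_const_lt (by simp)
  refine AnalyticOnNhd.eqOn_of_preconnected_of_eventuallyEq
    (((differentiableOn_unitMellin hρ.integrableOn).mul
      (differentiable_prod_inv_Gamma_add a).differentiableOn).analyticOnNhd hopen)
    (((differentiable_prod_inv_Gamma_add b).const_mul _).differentiableOn.analyticOnNhd hopen)
    (convex_halfSpace_re_gt 0).isPreconnected (z₀ := ((c + 1 : ℝ) : ℂ)) ?_ ?_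
  · rw [Set.mem_ofPred_eq, ofReal_re]
    positivity
  · filter_upwards [hright] with w hw
    have hGamma : ∏ i, Gamma (a i + w) ≠ 0 := Finset.prod_ne_zero_iff.2 fun i _ =>
      Gamma_ne_zero_of_re_pos (by rw [add_re]; linarith [ha i])
    rw [unitMellin_congr_ae (hρ.ae_eq_hypDensity hb ha),
      unitMellin_hypDensity ha (hρ.hypPsi_re_pos hb) hw, gammaProd.eq_def a b w,
      Finset.prod_inv_distrib, Finset.prod_inv_distrib]
    field_simp

/-- At `w = -a i`, were it in the closed half-plane where `unitMellin ρ` is finite, the left-hand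
side of `eqOn_unitMellin_mul_prod_inv_Gamma` would vanish, and the right-hand side would not. -/
theorem re_pos (hρ : HasHypMoments a b ρ) (hb : ∀ i, ∀ m : ℕ, b i ≠ -m) {i : Fin q}
    (hi : ∀ (j : Fin q) (l : ℕ), a i ≠ b j + l) : 0 < (a i).re := by
  by_contra! hre
  have hclosed := (hρ.eqOn_unitMellin_mul_prod_inv_Gamma hb).of_subset_closure
    ((continuousOn_unitMellin hρ.integrableOn).mul
      (differentiable_prod_inv_Gamma_add a).continuous.continuousOn)
    ((differentiable_prod_inv_Gamma_add b).continuous.const_mul _).continuousOn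
    (fun w (hw : 0 < w.re) => hw.le) (closure_setOfPred_lt_re 0).ge
  have hzero : ∏ j, (Gamma (a j + -a i))⁻¹ = 0 := Finset.prod_eq_zero (Finset.mem_univ i) (by simp)
  have heq := hclosed (show 0 ≤ (-a i).re by simpa using hre)
  simp only [hzero, mul_zero] at heq
  have hb_ne : ∏ j, (Gamma (b j + -a i))⁻¹ ≠ 0 := Finset.prod_ne_zero_iff.2 fun j _ =>
    inv_ne_zero (Gamma_ne_zero fun l hl => hi j l (by linear_combination -hl))
  exact mul_ne_zero (inv_ne_zero (gammaProd_zero_ne_zero hρ.ne_neg_natCast hb)) hb_ne heq.symm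

end HasHypMoments

end Necessity

theorem mainTheorem1 {q : ℕ} (σ : ℂ) (a b : Fin q → ℂ)
    (hb : ∀ (j : Fin q) (n : ℕ), b j ≠ -(n : ℂ)) :
    -- the criterion
    ((∀ n : ℕ, σ ≠ -(n : ℂ)) →
      (∀ (i j : Fin q) (l : ℕ), a i = b j + (l : ℂ) → 0 < (a i).re) →
      ((∃ ρ : ℝ → ℂ, IsRepresentedBy σ a b ρ) ↔
        (∀ i, 0 < (a i).re) ∧ 0 < (hypPsi a b).re)) ∧
    -- necessity, without excluding coincidences between upper and lower parameters
    ((∀ n : ℕ, σ ≠ -(n : ℂ)) → (∃ ρ : ℝ → ℂ, IsRepresentedBy σ a b ρ) →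
      0 < (hypPsi a b).re ∧
        ∀ i, (∀ (j : Fin q) (l : ℕ), a i ≠ b j + (l : ℂ)) → 0 < (a i).re) ∧
    -- sufficiency for every `σ`, with the explicit density, which is the only one
    ((∀ i, 0 < (a i).re) → 0 < (hypPsi a b).re →
      ∀ c : ℝ, (∀ i, -(a i).re < c) →
        (∀ s : ℝ, 0 < s → s < 1 →
          Tendsto (meijerGTrunc c b a (s : ℂ)) atTop (𝓝 (meijerG c b a (s : ℂ)))) ∧
        IsRepresentedBy σ a b (hypDensity c a b) ∧
        ((∀ n : ℕ, σ ≠ -(n : ℂ)) → ∀ ρ : ℝ → ℂ, IsRepresentedBy σ a b ρ →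
          ρ =ᵐ[volume.restrict (Set.Icc 0 1)] hypDensity c a b)) := by
  have necessity : (∀ n : ℕ, σ ≠ -(n : ℂ)) → (∃ ρ : ℝ → ℂ, IsRepresentedBy σ a b ρ) →
      0 < (hypPsi a b).re ∧
        ∀ i, (∀ (j : Fin q) (l : ℕ), a i ≠ b j + (l : ℂ)) → 0 < (a i).re := by
    rintro hσ ⟨ρ, hρ⟩
    have hmom := hρ.hasHypMoments hσ
    exact ⟨hmom.hypPsi_re_pos hb, fun i hi => hmom.re_pos hb hi⟩
  refine ⟨fun hσ hab => ⟨fun hex => ?_, fun ⟨ha, hψ⟩ => ?_⟩, necessity, fun ha hψ c hc => ?_⟩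
  · obtain ⟨hψ, hre⟩ := necessity hσ hex
    refine ⟨fun i => ?_, hψ⟩
    by_cases hi : ∃ (j : Fin q) (l : ℕ), a i = b j + (l : ℂ)
    · obtain ⟨j, l, hjl⟩ := hi
      exact hab i j l hjl
    · push Not at hi
      exact hre i hi
  · exact ⟨_, (hasHypMoments_hypDensity (c := 0) ha hb hψ (by simpa using ha)).isRepresentedBy σ⟩
  · have hdens := hasHypMoments_hypDensity ha hb hψ hc
    refine ⟨fun s hs hs₁ => tendsto_meijerGTrunc_meijerG hc hψ hs hs₁.ne, hdens.isRepresentedBy σ,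
      fun hσ ρ hρ => ?_⟩
    rw [← restrict_Ioo_eq_restrict_Icc]
    exact (hρ.hasHypMoments hσ).ae_eq hdens
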